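/- For $c\ge 0$ and $\tau\in[0,1)$ let $$Q^{\rm i}(z)=|z|^2-2c\log|z|,\qquad Q^{\rm e}(z)=\frac{|z|^2-\tau\operatorname{Re}z^2}{1-\tau^2}\qquad(z\in\mathbb C),$$ and for an integer $N\ge1$ let $$\mathcal Z_N(Q)=\int_{\mathbb C^N}\prod_{1\le j<k\le N}|z_j-z_k|^2\prod_{j=1}^N e^{-NQ(z_j)}\,\mathrm dA(z_j),\qquad \mathrm dA=\frac{\mathrm d^2z}{\pi}.$$ Let $G$ be the Barnes $G$-function, that is, the solution of $G(z+1)=\Gamma(z)G(z)$, $G(1)=1$, given by $$G(z+1)=(2\pi)^{z/2}\,e^{-\frac12z(z+1)-\frac12\gamma z^2}\prod_{n=1}^\infty\Big(1+\frac zn\Big)^n e^{-z+\frac{z^2}{2n}},$$ where $\gamma$ is Euler's constant. Let $\zeta$ be the Riemann zeta function, and let $B_k$ be the Bernoulli numbers, $\frac{t}{e^t-1}=\sum_{k\ge0}B_k\frac{t^k}{k!}$. Then for all $c\ge0$, $\tau\in[0,1)$ and $N\ge1$, $$\mathcal Z_N(Q^{\rm i})=N!\,\frac{G(N+cN+1)}{G(cN+1)}\,N^{-(c+\frac12)N^2-\frac12N},\qquad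 \mathcal Z_N(Q^{\rm e})=(1-\tau^2)^{N/2}\,G(N+2)\,N^{-\frac12N^2-\frac12N}.$$ Furthermore, for every fixed integer $K\ge0$, as $N\to\infty$: for every fixed $c>0$, $$\begin{aligned}\log\mathcal Z_N(Q^{\rm i})={}&-\Big(\frac34+\frac{3c}2+\frac{c^2}2\log c-\frac{(c+1)^2}2\log(c+1)\Big)N^2+\frac12N\log N+\Big(\frac{\log(2\pi)}2-1\Big)N\\&+\frac12\log N+\frac{\log(2\pi)}2+\frac1{12}\log\Big(\frac c{1+c}\Big)\\&+\sum_{k=1}^K\bigg(\frac{B_{2k}}{2k(2k-1)}\frac1{N^{2k-1}}+\frac{B_{2k+2}}{4k(k+1)}\Big(\frac1{(c+1)^{2k}}-\frac1{c^{2k}}\Big)\frac1{N^{2k}}\bigg)+O\big(N^{-2K-1}\big),\end{aligned}$$ and for every fixed $\tau\in[0,1)$, $$\begin{aligned}\log\mathcal Z_N(Q^{\rm e})={}&-\frac34N^2+\frac12N\log N+\Big(\frac{\log(2\pi)}2-1+\frac12\log(1-\tau^2)\Big)N\\&+\frac5{12}\log N+\frac{\log(2\pi)}2+\zeta'(-1)\\&+\sum_{k=1}^K\bigg(\frac{B_{2k}}{2k(2k-1)}\frac1{N^{2k-1}}+\frac{B_{2k+2}}{4k(k+1)}\frac1{N^{2k}}\bigg)+O\big(N^{-2K-1}\big).\end{aligned}$$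 -/

import Mathlib

open MeasureTheory

noncomputable section

/-- The induced Ginibre potential `|z|² - 2c log|z|`. At the single point `z = 0`, where the potential
is infinite for `c > 0`, it takes a finite value here; that point is a null set for area measure. -/
def inducedGinibrePotential (c : ℝ) (z : ℂ) : ℝ :=
  ‖z‖ ^ 2 - 2 * c * Real.log ‖z‖

/-- The elliptic Ginibre potential `(|z|² - τ Re z²) / (1 - τ²)`. -/
def ellipticGinibrePotential (τ : ℝ) (z : ℂ) : ℝ :=
  (‖z‖ ^ 2 - τ * (z ^ 2).re) / (1 - τ ^ 2)

/-- The normalised area measure `dA = d²z / π` on the complex plane. -/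
def areaMeasure : Measure ℂ :=
  ENNReal.ofReal (Real.pi⁻¹) • volume

/-- The partition function
`Z_N(Q) = ∫_{ℂ^N} ∏_{j < k} |z_j - z_k|² ∏_j exp(-N Q(z_j)) dA(z_j)`. -/
def partitionFunction (N : ℕ) (Q : ℂ → ℝ) : ℝ :=
  ∫ z : Fin N → ℂ,
    (∏ j : Fin N, ∏ k ∈ Finset.Ioi j, ‖z j - z k‖ ^ 2) *
      ∏ j : Fin N, Real.exp (-(N : ℝ) * Q (z j))
    ∂(Measure.pi fun _ : Fin N => areaMeasure)

/-- The Barnes `G`-function on the real line, by its Weierstrass product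
`G(z + 1) = (2π)^{z/2} exp(-z(z+1)/2 - γ z²/2) ∏_{n ≥ 1} (1 + z/n)^n exp(-z + z²/(2n))`.
It is the standard solution of `G(z + 1) = Γ(z) G(z)`, `G(1) = 1`. -/
def barnesG (x : ℝ) : ℝ :=
  (2 * Real.pi) ^ ((x - 1) / 2) *
    Real.exp (-((x - 1) * x) / 2 - Real.eulerMascheroniConstant * (x - 1) ^ 2 / 2) *
    ∏' n : ℕ, ((1 + (x - 1) / ((n : ℝ) + 1)) ^ (n + 1) *
      Real.exp (-(x - 1) + (x - 1) ^ 2 / (2 * ((n : ℝ) + 1))))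

end

/-! Expand the squared Vandermonde determinant in monic polynomials orthogonal for the weight. Only
pairs of equal permutations survive integration, so the partition function is N! times the product
of the first N squared norms (`integral_prod_norm_sub_sq`). For the induced potential the weight is
radial, the polynomials are monomials, and the norms are Gamma values whose product telescopes to a
quotient of Barnes functions through G(x+1) = Γ(x)G(x). For the elliptic potential the weight is an
anisotropic Gaussian and the polynomials are rescaled Hermite polynomials; integration by parts
(`gaussianForm_X_mul`) gives their norms, and the factorials multiply up to G(N+2).

The expansions then reduce to those of log N! and log G(z+1). Stirling's series comes from
Euler–Maclaurin summation with a uniform remainder, its constant from the classical Stirling limit.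
For G one studies log H(z) = z log Γ(z+1) - log G(z+1), whose derivative is log Γ(z+1) plus an
affine function: Stirling's series integrates term by term and determines log G up to a constant
(`log_barnesG_sub_isBigO`).

At integers log H is the sum of k log k, which also appears on differentiating an Euler–Maclaurin
accelerated series for (s-1)ζ(s) at s = -1. This identifies the constant through ζ'(-1)
(`tendsto_logHyperfactorial_sub`). It cancels in the Barnes quotient of the induced case and
survives in the elliptic one. -/

noncomputable section

open Filter Topology Set Asymptotics
open scoped ComplexConjugate

/-! ### Euler–Maclaurin summation with remainder -/

/-- Euler--Maclaurin summation on the unit interval. -/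
theorem eulerMaclaurin_unit {E : Type*} [NormedAddCommGroup E] [NormedSpace ℝ E] [CompleteSpace E]
    {f : ℕ → ℝ → E} (hf : ∀ k, ∀ x ∈ Icc (0 : ℝ) 1, HasDerivAt (f k) (f (k + 1) x) x) (m : ℕ) :
    f 1 1 = ∑ k ∈ Finset.range (m + 2), ((bernoulli' k : ℝ) / k.factorial) • (f k 1 - f k 0) +
      (-1 : ℝ) ^ m •
        ∫ x in (0 : ℝ)..1, (bernoulliFun (m + 1) x / (m + 1).factorial) • f (m + 2) x := by
  have hI : uIcc (0 : ℝ) 1 = Icc 0 1 := uIcc_of_le zero_le_one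
  have hint : ∀ k, IntervalIntegrable (f k) volume 0 1 := fun k =>
    ContinuousOn.intervalIntegrable (by
      rw [hI]; exact fun x hx => (hf k x hx).continuousAt.continuousWithinAt)
  have hb : ∀ k x, HasDerivAt (fun x => bernoulliFun (k + 1) x / (k + 1).factorial)
      (bernoulliFun k x / k.factorial) x := fun k x => by
    refine ((hasDerivAt_bernoulliFun (k + 1) x).div_const ((k + 1).factorial : ℝ)).congr_deriv ?_
    rw [Nat.factorial_succ]
    push_cast
    have : (k.factorial : ℝ) ≠ 0 := by positivity
    field_simp
  have hparts : ∀ k, ∫ x in (0 : ℝ)..1, (bernoulliFun (k + 1) x / (k + 1).factorial) • f (k + 2) x =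
      (bernoulliFun (k + 1) 1 / (k + 1).factorial) • f (k + 1) 1 -
      (bernoulliFun (k + 1) 0 / (k + 1).factorial) • f (k + 1) 0 -
      ∫ x in (0 : ℝ)..1, (bernoulliFun k x / k.factorial) • f (k + 1) x := fun k => by
    refine intervalIntegral.integral_smul_deriv_eq_deriv_smul (fun x _ => hb k x)
      (fun x hx => hf (k + 1) x (hI ▸ hx)) ?_ (hint _)
    exact ((continuous_bernoulliFun k).div_const _).intervalIntegrable _ _
  -- Each step is one integration by parts against the next Bernoulli polynomial. The convention
  -- `bernoulli'`, with B_1 = +1/2, is what puts `f 1 1` alone on the left.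
  induction m with
  | zero =>
    have h0 : ∫ x in (0 : ℝ)..1, (bernoulliFun 0 x / (Nat.factorial 0 : ℝ)) • f (0 + 1) x =
        f 0 1 - f 0 0 := by
      simp only [bernoulliFun_zero, Nat.factorial_zero, Nat.cast_one, div_one, one_smul]
      exact intervalIntegral.integral_eq_sub_of_hasDerivAt (fun x hx => hf 0 x (hI ▸ hx)) (hint 1)
    rw [hparts 0, h0]
    simp [Finset.sum_range_succ, bernoulliFun_one]
    module
  | succ m ih =>
    rw [Finset.sum_range_succ, hparts (m + 1)]
    have e1 : bernoulliFun (m + 1 + 1) 1 = bernoulliFun (m + 1 + 1) 0 := by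
      rw [bernoulliFun_eval_one]; simp
    have e2 : (bernoulli' (m + 2) : ℝ) = (-1 : ℝ) ^ m * bernoulliFun (m + 1 + 1) 0 := by
      rw [bernoulliFun_eval_zero, bernoulli]
      push_cast
      rw [← mul_assoc, ← pow_add, show m + (m + 1 + 1) = 2 * (m + 1) by ring]
      simp [pow_mul]
    rw [e1, e2]
    nth_rewrite 1 [ih]
    rw [pow_succ]
    module

/-- The remainder kernel is a Bernoulli polynomial, bounded on [0,1], so the constant depends on m
only. Values in a general space allow both the real use (for log) and the complex one (for ζ). -/
theorem exists_eulerMaclaurin_bound (m : ℕ) : ∃ C : ℝ, 0 ≤ C ∧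
    ∀ {E : Type} [NormedAddCommGroup E] [NormedSpace ℝ E] [CompleteSpace E]
    {f : ℕ → ℝ → E} (_ : ∀ k, ∀ x ∈ Icc (0 : ℝ) 1, HasDerivAt (f k) (f (k + 1) x) x) (B : ℝ)
    (_ : ∀ x ∈ Icc (0 : ℝ) 1, ‖f (m + 2) x‖ ≤ B),
    ‖f 1 1 - ∑ k ∈ Finset.range (m + 2),
      ((bernoulli' k : ℝ) / k.factorial) • (f k 1 - f k 0)‖ ≤ C * B := by
  obtain ⟨C, hC⟩ := isCompact_Icc.exists_bound_of_continuousOn (s := Icc (0 : ℝ) 1)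
    ((continuous_bernoulliFun (m + 1)).div_const ((m + 1).factorial : ℝ)).continuousOn
  have hC0 : 0 ≤ C := (norm_nonneg _).trans (hC 0 (by simp))
  refine ⟨C, hC0, fun {E} _ _ _ f hf B hB => ?_⟩
  have hem := eulerMaclaurin_unit hf m
  rw [← eq_sub_iff_add_eq'.mpr hem.symm, norm_smul]
  simp only [norm_pow, norm_neg, norm_one, one_pow, one_mul]
  have := intervalIntegral.norm_integral_le_of_norm_le_const (a := (0 : ℝ)) (b := 1) (C := C * B)
    (f := fun x => (bernoulliFun (m + 1) x / (m + 1).factorial) • f (m + 2) x) (fun x hx => by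
      rw [uIoc_of_le zero_le_one] at hx
      have hx' : x ∈ Icc (0 : ℝ) 1 := ⟨hx.1.le, hx.2⟩
      rw [norm_smul]
      exact mul_le_mul (hC x hx') (hB x hx') (norm_nonneg _) hC0)
  simpa using this

/-! ### Stirling's series for log Γ -/

/-- `z log z - z`, its derivative `log z`, and the iterated derivatives of `log`. -/
def logDerivSeq : ℕ → ℝ → ℝ
  | 0, z => z * Real.log z - z
  | 1, z => Real.log z
  | k + 2, z => (-1) ^ k * k.factorial / z ^ (k + 1)

theorem hasDerivAt_logDerivSeq (k : ℕ) {z : ℝ} (hz : 0 < z) :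
    HasDerivAt (logDerivSeq k) (logDerivSeq (k + 1) z) z := by
  match k with
  | 0 =>
    have := ((hasDerivAt_id z).mul (Real.hasDerivAt_log hz.ne')).sub (hasDerivAt_id z)
    refine this.congr_deriv ?_
    simp [logDerivSeq, hz.ne']
  | 1 =>
    refine (Real.hasDerivAt_log hz.ne').congr_deriv ?_
    simp [logDerivSeq]
  | k + 2 =>
    have := ((hasDerivAt_pow (k + 1) z).inv (by positivity)).const_mul
      ((-1) ^ k * k.factorial : ℝ)
    have h2 : HasDerivAt (logDerivSeq (k + 2)) _ z := this
    refine h2.congr_deriv ?_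
    simp only [logDerivSeq, Nat.factorial_succ, Nat.add_sub_cancel]
    push_cast
    field_simp
    ring

/-- The Euler--Maclaurin antidifference of `log`, truncated after `m` correction terms. -/
def logAntidifference (m : ℕ) (z : ℝ) : ℝ :=
  ∑ k ∈ Finset.range (m + 2), (bernoulli' k : ℝ) / k.factorial * logDerivSeq k z

theorem exists_logAntidifference_bound (m : ℕ) : ∃ C : ℝ, 0 ≤ C ∧ ∀ z : ℝ, 0 < z →
    |Real.log (z + 1) - (logAntidifference m (z + 1) - logAntidifference m z)| ≤
      C / z ^ (m + 1) := by
  obtain ⟨C, hC0, hC⟩ := exists_eulerMaclaurin_bound m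
  refine ⟨C * m.factorial, by positivity, fun z hz => ?_⟩
  have := hC (f := fun k x => logDerivSeq k (z + x)) (fun k x hx =>
    HasDerivAt.comp_const_add z x (hasDerivAt_logDerivSeq k (by linarith [hx.1])))
    (m.factorial / z ^ (m + 1)) (fun x hx => by
      have hx0 := hx.1
      simp only [logDerivSeq, norm_div, norm_mul, norm_pow, norm_neg, norm_one, one_pow, one_mul,
        Real.norm_natCast]
      rw [Real.norm_of_nonneg (by positivity)]
      gcongr
      linarith)
  simp only [Real.norm_eq_abs, smul_eq_mul, add_zero, mul_sub, Finset.sum_sub_distrib] at this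
  rw [mul_div_assoc]
  exact this

/-- Telescoping to infinity: the increments are summed by 1/(z+n)² ≤ 1/(z+n-1) - 1/(z+n), which
costs one power of z. The condition z ≥ 2 gives 1/(z-1) ≤ 2/z, the source of the factor 2. -/
theorem abs_le_of_abs_sub_le_div_pow {E : ℝ → ℝ} {C : ℝ} (hC : 0 ≤ C) {p : ℕ} (hp : 1 ≤ p)
    (hE : ∀ z, 0 < z → |E (z + 1) - E z| ≤ C / z ^ (p + 1))
    (hlim : ∀ z, 0 < z → Tendsto (fun n : ℕ => E (z + n)) atTop (𝓝 0)) {z : ℝ} (hz : 2 ≤ z) :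
    |E z| ≤ 2 * C / z ^ p := by
  have hz0 : 0 < z := by linarith
  have hz1 : 0 < z - 1 := by linarith
  have key : ∀ n : ℕ, |E z| ≤ |E (z + n)| + C / z ^ (p - 1) * (1 / (z - 1) - 1 / (z + n - 1)) := by
    intro n
    induction n with
    | zero => simp
    | succ n ih =>
      have hn : (0 : ℝ) ≤ n := n.cast_nonneg
      have h1 := hE (z + n) (by linarith)
      have h2 : |E (z + n)| ≤ |E (z + n + 1)| + |E (z + n + 1) - E (z + n)| := by
        have := abs_sub_abs_le_abs_sub (E (z + n)) (E (z + n + 1))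
        rw [abs_sub_comm] at this
        linarith
      have h3 : C / (z + n) ^ (p + 1) ≤
          C / z ^ (p - 1) * (1 / (z + n - 1) - 1 / (z + n)) := by
        have e : p + 1 = (p - 1) + 2 := by omega
        rw [e, pow_add, ← div_div, div_eq_mul_one_div (C / (z + n) ^ (p - 1))]
        have hpos : 0 < z + n - 1 := by linarith
        have h4 : 1 / (z + n) ^ 2 ≤ 1 / (z + n - 1) - 1 / (z + n) := by
          rw [div_sub_div _ _ hpos.ne' (by linarith), div_le_div_iff₀ (by positivity) (by positivity)]
          nlinarith
        gcongr
        linarith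
      push_cast
      rw [show z + (n + 1 : ℝ) = z + n + 1 by ring, show z + n + 1 - 1 = z + n by ring]
      have : C / z ^ (p - 1) * (1 / (z - 1) - 1 / (z + n)) =
        C / z ^ (p - 1) * (1 / (z - 1) - 1 / (z + n - 1)) +
        C / z ^ (p - 1) * (1 / (z + n - 1) - 1 / (z + n)) := by ring
      linarith
  have key2 : ∀ n : ℕ, |E z| ≤ |E (z + n)| + 2 * C / z ^ p := by
    intro n
    refine (key n).trans ?_
    have hn : (0 : ℝ) ≤ n := n.cast_nonneg
    have h5 : 0 ≤ 1 / (z + n - 1) := by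
      have : 0 < z + n - 1 := by linarith
      positivity
    have h6 : 1 / (z - 1) ≤ 2 / z := by
      rw [div_le_div_iff₀ hz1 hz0]; linarith
    have e : z ^ p = z ^ (p - 1) * z := by
      rw [← pow_succ]; congr 1; omega
    have : C / z ^ (p - 1) * (1 / (z - 1) - 1 / (z + n - 1)) ≤ C / z ^ (p - 1) * (2 / z) := by
      gcongr; linarith
    have e2 : 2 * C / z ^ p = C / z ^ (p - 1) * (2 / z) := by
      rw [e]; field_simp
    linarith
  have ht : Tendsto (fun n : ℕ => |E (z + n)| + 2 * C / z ^ p) atTop (𝓝 (|0| + 2 * C / z ^ p)) :=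
    ((hlim z hz0).abs).add_const _
  simpa using ge_of_tendsto' ht key2

theorem log_Gamma_add_natCast {x : ℝ} (hx : 0 < x) (n : ℕ) :
    Real.log (Real.Gamma (x + n)) =
      Real.log (Real.Gamma x) + ∑ m ∈ Finset.range n, Real.log (x + m) := by
  induction n with
  | zero => simp
  | succ n ih =>
    have hn : (0 : ℝ) ≤ n := n.cast_nonneg
    rw [Finset.sum_range_succ, ← add_assoc, ← ih]
    push_cast
    rw [← add_assoc, Real.Gamma_add_one (by positivity), Real.log_mul (by positivity)
      (Real.Gamma_pos_of_pos (by positivity)).ne']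
    ring

theorem tendsto_log_factorial_sub :
    Tendsto (fun n : ℕ => Real.log n.factorial - (n * Real.log n - n + Real.log n / 2)) atTop
      (𝓝 (Real.log (2 * Real.pi) / 2)) := by
  have h := (Real.continuousAt_log (Real.sqrt_pos.mpr Real.pi_pos).ne').tendsto.comp
    Stirling.tendsto_stirlingSeq_sqrt_pi
  have h2 := h.add_const (Real.log 2 / 2)
  have e : Real.log √Real.pi + Real.log 2 / 2 = Real.log (2 * Real.pi) / 2 := by
    rw [Real.log_sqrt Real.pi_pos.le, Real.log_mul two_ne_zero Real.pi_ne_zero]; ring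
  rw [e] at h2
  refine h2.congr' ?_
  filter_upwards [eventually_gt_atTop 0] with n hn
  have hn' : (n : ℝ) ≠ 0 := by positivity
  simp only [Function.comp, Stirling.log_stirlingSeq_formula]
  rw [Real.log_mul two_ne_zero hn', Real.log_div hn' (Real.exp_ne_zero _), Real.log_exp]
  ring

/-- The Bohr–Mollerup limit compares Γ(z+n+1) with n^z n!, which carries Stirling's limit from
factorials to every shifted sequence z + n. -/
theorem tendsto_log_Gamma_sub {z : ℝ} (hz : 0 < z) :
    Tendsto (fun n : ℕ => Real.log (Real.Gamma (z + n + 1)) -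
      ((z + n) * Real.log (z + n) - (z + n) + Real.log (z + n) / 2)) atTop
      (𝓝 (Real.log (2 * Real.pi) / 2)) := by
  have h1 : Tendsto (fun n : ℕ => Real.log (Real.Gamma (z + n + 1)) -
      (z * Real.log n + Real.log n.factorial)) atTop (𝓝 0) := by
    have := (Real.BohrMollerup.tendsto_log_gamma hz).const_sub (Real.log (Real.Gamma z))
    rw [sub_self] at this
    refine this.congr fun n => ?_
    have := log_Gamma_add_natCast hz (n + 1)
    push_cast at this
    rw [← add_assoc] at this
    rw [this, Real.BohrMollerup.logGammaSeq]
    ring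
  have h2 : Tendsto (fun n : ℕ => (n : ℝ) * Real.log (1 + z / n)) atTop (𝓝 z) :=
    (Real.tendsto_mul_log_one_add_div_atTop z).comp tendsto_natCast_atTop_atTop
  have h3 : Tendsto (fun n : ℕ => Real.log (1 + z / n)) atTop (𝓝 0) := by
    have : Tendsto (fun n : ℕ => 1 + z / (n : ℝ)) atTop (𝓝 (1 + 0)) :=
      (tendsto_const_div_atTop_nhds_zero_nat z).const_add 1
    rw [add_zero] at this
    simpa using! (Real.continuousAt_log one_ne_zero).tendsto.comp this
  have h4 := ((h1.add tendsto_log_factorial_sub).sub (h2.add (h3.const_mul (z + 1 / 2)))).add_const z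
  have e : 0 + Real.log (2 * Real.pi) / 2 - (z + (z + 1 / 2) * 0) + z =
    Real.log (2 * Real.pi) / 2 := by ring
  rw [e] at h4
  refine h4.congr' ?_
  filter_upwards [eventually_gt_atTop 0] with n hn
  have hn' : (0 : ℝ) < n := by positivity
  have : Real.log (z + n) = Real.log n + Real.log (1 + z / n) := by
    rw [← Real.log_mul hn'.ne' (by positivity)]
    congr 1
    field_simp
    ring
  rw [this]
  ring

theorem logAntidifference_zero (z : ℝ) :
    logAntidifference 0 z = z * Real.log z - z + Real.log z / 2 := by
  simp [logAntidifference, Finset.sum_range_succ, logDerivSeq]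
  ring

theorem logAntidifference_succ (m : ℕ) (z : ℝ) :
    logAntidifference (m + 1) z = logAntidifference m z +
      (-1) ^ m * (bernoulli' (m + 2) : ℝ) / ((m + 2) * (m + 1)) / z ^ (m + 1) := by
  rw [logAntidifference, Finset.sum_range_succ, ← logAntidifference]
  congr 1
  simp only [logDerivSeq, Nat.factorial_succ]
  push_cast
  have : (m.factorial : ℝ) ≠ 0 := by positivity
  field_simp
  ring

theorem tendsto_logAntidifference_sub (m : ℕ) :
    Tendsto (fun z => logAntidifference m z - (z * Real.log z - z + Real.log z / 2)) atTop
      (𝓝 0) := by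
  induction m with
  | zero => simp [logAntidifference_zero]
  | succ m ih =>
    have := ih.add ((tendsto_pow_atTop (α := ℝ) (Nat.succ_ne_zero m)).const_div_atTop
      ((-1) ^ m * (bernoulli' (m + 2) : ℝ) / ((m + 2) * (m + 1))))
    rw [add_zero] at this
    refine this.congr fun z => ?_
    rw [logAntidifference_succ, Nat.succ_eq_add_one]
    ring

/-- By Γ(z+2) = (z+1)Γ(z+1), the increment of the error is exactly the Euler–Maclaurin remainder.
Stirling's limit makes the error vanish along z + n, so telescoping applies. -/
theorem exists_log_Gamma_sub_logAntidifference_bound {m : ℕ} (hm : 1 ≤ m) :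
    ∃ C : ℝ, ∀ z : ℝ, 2 ≤ z →
      |Real.log (Real.Gamma (z + 1)) - Real.log (2 * Real.pi) / 2 - logAntidifference m z| ≤
        C / z ^ m := by
  obtain ⟨C, hC0, hC⟩ := exists_logAntidifference_bound m
  refine ⟨2 * C, fun z hz => abs_le_of_abs_sub_le_div_pow (E := fun z =>
    Real.log (Real.Gamma (z + 1)) - Real.log (2 * Real.pi) / 2 - logAntidifference m z)
    hC0 hm (fun z hz => ?_) (fun z hz => ?_) hz⟩
  · refine le_of_eq_of_le ?_ (hC z hz)
    have h1 : 0 < z + 1 := by linarith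
    rw [Real.Gamma_add_one h1.ne', Real.log_mul h1.ne' (Real.Gamma_pos_of_pos h1).ne']
    congr 1
    ring
  · have h1 := (tendsto_log_Gamma_sub hz).sub_const (Real.log (2 * Real.pi) / 2)
    have h2 := (tendsto_logAntidifference_sub m).comp
      (tendsto_atTop_add_const_left atTop z tendsto_natCast_atTop_atTop)
    have h3 := h1.sub h2
    rw [sub_self, sub_zero] at h3
    refine h3.congr fun n => ?_
    simp only [Function.comp]
    ring

/-- Stirling's series for `log Γ (z + 1)`, truncated after `K` correction terms. -/
def stirlingSeries (K : ℕ) (z : ℝ) : ℝ :=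
  z * Real.log z - z + Real.log z / 2 + Real.log (2 * Real.pi) / 2 +
    ∑ k ∈ Finset.Icc 1 K, (bernoulli (2 * k) : ℝ) / (2 * k * (2 * k - 1)) * (1 / z ^ (2 * k - 1))

theorem stirlingSeries_eq_logAntidifference (K : ℕ) (z : ℝ) :
    stirlingSeries K z = Real.log (2 * Real.pi) / 2 + logAntidifference (2 * K) z := by
  induction K with
  | zero => simp [stirlingSeries, logAntidifference_zero]; ring
  | succ K ih =>
    have h1 : stirlingSeries (K + 1) z = stirlingSeries K z +
      (bernoulli (2 * (K + 1)) : ℝ) / (2 * (K + 1 : ℕ) * (2 * (K + 1 : ℕ) - 1)) *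
        (1 / z ^ (2 * (K + 1) - 1)) := by
      rw [stirlingSeries, Finset.sum_Icc_succ_top (by omega), ← add_assoc, ← stirlingSeries]
    rw [h1, ih, show 2 * (K + 1) = 2 * K + 1 + 1 by ring, logAntidifference_succ,
      logAntidifference_succ, bernoulli'_eq_zero_of_odd (n := 2 * K + 1 + 2) ⟨K + 1, by ring⟩
      (by omega), bernoulli_eq_bernoulli'_of_ne_one (by omega)]
    simp only [Nat.add_sub_cancel, pow_mul, neg_one_sq, one_pow]
    push_cast
    rw [show (2 * ((K : ℝ) + 1) - 1) = 2 * K + 1 by ring]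
    ring

/-- Stirling's series is an asymptotic expansion of `log Γ (z + 1)` on the real line. -/
theorem log_Gamma_sub_stirlingSeries_isBigO (K : ℕ) :
    (fun z : ℝ => Real.log (Real.Gamma (z + 1)) - stirlingSeries K z) =O[atTop]
      fun z => 1 / z ^ (2 * K + 1) := by
  -- The bound for m = 2K is one power too weak. Taking m = 2K + 1 gives the right order, and the
  -- extra term is itself a multiple of 1/z^(2K+1).
  obtain ⟨C, hC⟩ := exists_log_Gamma_sub_logAntidifference_bound (m := 2 * K + 1) (by omega)
  have h1 : (fun z : ℝ => Real.log (Real.Gamma (z + 1)) - Real.log (2 * Real.pi) / 2 -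
      logAntidifference (2 * K + 1) z) =O[atTop] fun z => 1 / z ^ (2 * K + 1) := by
    refine IsBigO.of_bound C ?_
    filter_upwards [eventually_ge_atTop 2] with z hz
    have hz0 : 0 < z := by linarith
    rw [Real.norm_eq_abs, Real.norm_of_nonneg (by positivity), mul_one_div]
    exact hC z hz
  have h2 := h1.add (isBigO_const_mul_self
    ((-1) ^ (2 * K) * (bernoulli' (2 * K + 2) : ℝ) / (((2 * K : ℕ) + 2) * ((2 * K : ℕ) + 1)))
    (fun z : ℝ => 1 / z ^ (2 * K + 1)) atTop)
  refine h2.congr_left fun z => ?_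
  rw [stirlingSeries_eq_logAntidifference, logAntidifference_succ]
  ring

/-! ### Weierstrass series, the hyperfactorial and the Barnes function -/

/-- The `n`-th term of the Weierstrass series of `log Γ (z + 1) + γ z`. -/
def logGammaTerm (n : ℕ) (z : ℝ) : ℝ :=
  z / (n + 1) - Real.log (1 + z / (n + 1))

/-- The antiderivative of `logGammaTerm n` vanishing at `0`. -/
def logGammaTermIntegral (n : ℕ) (z : ℝ) : ℝ :=
  z ^ 2 / (2 * (n + 1)) + z - (z + (n + 1)) * Real.log (1 + z / (n + 1))

/-- The half-line z > -1/2 is open and contains 0, so derivatives make sense at 0, while every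
factor stays uniformly away from 0. -/
theorem one_add_div_pos {z : ℝ} (hz : -1 / 2 < z) (n : ℕ) : 1 / 2 < 1 + z / ((n : ℝ) + 1) := by
  have hn : (0 : ℝ) ≤ n := n.cast_nonneg
  rw [← sub_pos, show 1 + z / ((n : ℝ) + 1) - 1 / 2 = (n / 2 + 1 / 2 + z) / (n + 1) by
    field_simp; ring]
  apply div_pos <;> linarith

theorem abs_logGammaTerm_le {z : ℝ} (hz : -1 / 2 < z) (n : ℕ) :
    |logGammaTerm n z| ≤ 2 * z ^ 2 * (1 / ((n : ℝ) + 1) ^ 2) := by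
  have h := one_add_div_pos hz n
  rw [show 2 * z ^ 2 * (1 / ((n : ℝ) + 1) ^ 2) =
    2 * (z / (n + 1)) ^ 2 by rw [div_pow]; ring]
  rw [logGammaTerm]
  set x := z / ((n : ℝ) + 1)
  have hx : 0 < 1 + x := by linarith
  have h1 := Real.log_le_sub_one_of_pos hx
  have h2 := Real.one_sub_inv_le_log_of_pos hx
  rw [abs_of_nonneg (by linarith)]
  have h3 : x - (1 - (1 + x)⁻¹) = x ^ 2 * (1 + x)⁻¹ := by field_simp; ring
  have h4 : (1 + x)⁻¹ ≤ 2 := by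
    rw [inv_le_comm₀ hx two_pos]; linarith
  nlinarith [sq_nonneg x]

theorem hasDerivAt_logGammaTermIntegral {z : ℝ} (hz : -1 / 2 < z) (n : ℕ) :
    HasDerivAt (logGammaTermIntegral n) (logGammaTerm n z) z := by
  have h := one_add_div_pos hz n
  have h1 : HasDerivAt (fun z : ℝ => 1 + z / ((n : ℝ) + 1)) (1 / (n + 1)) z :=
    ((hasDerivAt_id z).div_const _).const_add 1
  have h0 : 1 + z / ((n : ℝ) + 1) ≠ 0 := by linarith
  have h2 := h1.log h0
  have h3 := (((hasDerivAt_pow 2 z).div_const (2 * ((n : ℝ) + 1))).add (hasDerivAt_id z)).sub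
    (((hasDerivAt_id z).add_const ((n : ℝ) + 1)).mul h2)
  refine h3.congr_deriv ?_
  rw [logGammaTerm]
  have hn : (n : ℝ) + 1 ≠ 0 := by positivity
  have e : (z + ((n : ℝ) + 1)) * (1 / (n + 1) / (1 + z / (n + 1))) = 1 := by
    rw [div_div, mul_one_div, div_eq_one_iff_eq (mul_ne_zero hn h0)]
    field_simp
    ring
  simp only [id]
  rw [e]
  field_simp
  ring

theorem summable_one_div_add_one_sq : Summable fun n : ℕ => 1 / ((n : ℝ) + 1) ^ 2 := by
  simpa using (summable_nat_add_iff 1).mpr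
    (Real.summable_one_div_nat_pow.mpr (one_lt_two : 1 < 2))

theorem summable_logGammaTerm {z : ℝ} (hz : -1 / 2 < z) : Summable (logGammaTerm · z) :=
  Summable.of_norm_bounded (summable_one_div_add_one_sq.mul_left _)
    fun n => abs_logGammaTerm_le hz n

theorem logGammaTermIntegral_zero (n : ℕ) : logGammaTermIntegral n 0 = 0 := by
  simp [logGammaTermIntegral]

theorem norm_logGammaTerm_le_of_mem {R z : ℝ} (hz : z ∈ Ioo (-1 / 2) R) (n : ℕ) :
    ‖logGammaTerm n z‖ ≤ 2 * (R ^ 2 + 1) * (1 / ((n : ℝ) + 1) ^ 2) := by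
  refine (abs_logGammaTerm_le hz.1 n).trans ?_
  gcongr
  rcases le_or_gt 0 z with h | h
  · nlinarith [hz.2]
  · nlinarith [hz.1, sq_nonneg R]

theorem summable_logGammaTermIntegral {z : ℝ} (hz : -1 / 2 < z) :
    Summable (logGammaTermIntegral · z) := by
  refine summable_of_summable_hasDerivAt_of_isPreconnected (t := Ioo (-1 / 2) (|z| + 1)) (y₀ := 0)
    (summable_one_div_add_one_sq.mul_left _) isOpen_Ioo isPreconnected_Ioo
    (fun n y hy => hasDerivAt_logGammaTermIntegral hy.1 n)
    (fun n y hy => norm_logGammaTerm_le_of_mem hy n) ⟨by norm_num, by positivity⟩ ?_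
    ⟨hz, by linarith [le_abs_self z]⟩
  simp only [logGammaTermIntegral_zero]
  exact summable_zero

theorem hasDerivAt_tsum_logGammaTermIntegral {z : ℝ} (hz : -1 / 2 < z) :
    HasDerivAt (fun z => ∑' n, logGammaTermIntegral n z) (∑' n, logGammaTerm n z) z := by
  refine hasDerivAt_tsum_of_isPreconnected (t := Ioo (-1 / 2) (|z| + 1)) (y₀ := 0)
    (summable_one_div_add_one_sq.mul_left _) isOpen_Ioo isPreconnected_Ioo
    (fun n y hy => hasDerivAt_logGammaTermIntegral hy.1 n)
    (fun n y hy => norm_logGammaTerm_le_of_mem hy n) ⟨by norm_num, by positivity⟩ ?_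
    ⟨hz, by linarith [le_abs_self z]⟩
  simp only [logGammaTermIntegral_zero]
  exact summable_zero

theorem tendsto_log_sub_log_add_one :
    Tendsto (fun n : ℕ => Real.log n - Real.log (n + 1)) atTop (𝓝 0) := by
  have := Real.tendsto_log_nat_add_one_sub_log.neg
  rw [neg_zero] at this
  exact this.congr fun n => by ring

theorem harmonic_eq_sum (n : ℕ) :
    ((harmonic n : ℚ) : ℝ) = ∑ i ∈ Finset.range n, 1 / ((i : ℝ) + 1) := by
  simp [harmonic]

theorem sum_log_add_one (n : ℕ) :
    ∑ i ∈ Finset.range n, Real.log ((i : ℝ) + 1) = Real.log n.factorial := by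
  induction n with
  | zero => simp
  | succ n ih =>
    rw [Finset.sum_range_succ, ih, Nat.factorial_succ]
    push_cast
    rw [Real.log_mul (by positivity) (by positivity), add_comm]

theorem tsum_logGammaTerm {z : ℝ} (hz : -1 / 2 < z) :
    ∑' n, logGammaTerm n z =
      Real.log (Real.Gamma (z + 1)) + Real.eulerMascheroniConstant * z := by
  have h1 := (Real.BohrMollerup.tendsto_log_gamma (x := z + 1) (by linarith))
  have h2 := (summable_logGammaTerm hz).hasSum.tendsto_sum_nat.comp (tendsto_add_atTop_nat 1)
  have h3 := (Real.tendsto_harmonic_sub_log.comp (tendsto_add_atTop_nat 1)).const_mul z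
  -- `logGammaSeq` carries log n, whereas the sums of n + 1 terms produce log (n+1); this null
  -- sequence corrects the mismatch.
  have h4 := (h2.sub h3).add (tendsto_log_sub_log_add_one.const_mul (z + 1))
  rw [mul_zero, add_zero] at h4
  have := tendsto_nhds_unique h4 (h1.congr fun n => ?_)
  · linarith
  · simp only [Function.comp, Real.BohrMollerup.logGammaSeq, logGammaTerm,
      Finset.sum_sub_distrib, harmonic_eq_sum, Finset.mul_sum, mul_one_div, mul_sub]
    have e : ∀ i : ℕ, Real.log (z + 1 + i) =
        Real.log (i + 1) + Real.log (1 + z / ((i : ℝ) + 1)) := fun i => by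
      have := one_add_div_pos hz i
      rw [← Real.log_mul (by positivity) (by linarith)]
      congr 1
      field_simp
      ring
    simp only [e, Finset.sum_add_distrib, sum_log_add_one, Nat.factorial_succ]
    push_cast
    rw [Real.log_mul (by positivity) (by positivity)]
    ring

/-- `z log Γ (z + 1) - log G (z + 1)`, the logarithm of the hyperfactorial function. -/
def logHyperfactorial (z : ℝ) : ℝ :=
  -Real.eulerMascheroniConstant * z ^ 2 / 2 + z * (z + 1) / 2 - z / 2 * Real.log (2 * Real.pi) +
    ∑' n, logGammaTermIntegral n z

theorem logHyperfactorial_zero : logHyperfactorial 0 = 0 := by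
  simp [logHyperfactorial, logGammaTermIntegral_zero]

/-- This is the reason for using the hyperfactorial: its derivative involves only log Γ, whereas
that of log G would bring in the digamma function. -/
theorem hasDerivAt_logHyperfactorial {z : ℝ} (hz : -1 / 2 < z) :
    HasDerivAt logHyperfactorial
      (Real.log (Real.Gamma (z + 1)) + z + 1 / 2 - Real.log (2 * Real.pi) / 2) z := by
  have h := ((((hasDerivAt_pow 2 z).const_mul (-Real.eulerMascheroniConstant)).div_const 2).add
    (((hasDerivAt_id z).mul ((hasDerivAt_id z).add_const 1)).div_const 2)).sub
    (((hasDerivAt_id z).div_const 2).mul_const (Real.log (2 * Real.pi)))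
  refine (h.add (hasDerivAt_tsum_logGammaTermIntegral hz)).congr_deriv ?_
  rw [tsum_logGammaTerm hz]
  simp only [id]
  push_cast
  ring

theorem sum_logGammaTermIntegral_one (N : ℕ) :
    ∑ n ∈ Finset.range N, logGammaTermIntegral n 1 =
      (harmonic N : ℝ) / 2 + N - (N + 1) * Real.log (N + 1) + Real.log N.factorial := by
  induction N with
  | zero => simp
  | succ N ih =>
    rw [Finset.sum_range_succ, ih, harmonic_succ, Nat.factorial_succ, logGammaTermIntegral]
    have : (1 : ℝ) + 1 / (N + 1) = (N + 2) / (N + 1) := by field_simp; ring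
    rw [this, Real.log_div (by positivity) (by positivity)]
    push_cast
    rw [Real.log_mul (by positivity) (by positivity)]
    have e : (N : ℝ) + 1 + 1 = N + 2 := by ring
    rw [e]
    field_simp
    ring

/-- The partial sums at z = 1 have a closed form in the harmonic number and the factorial, so
Euler's constant and Stirling's limit evaluate the series. The value fixes the constant in the
functional equation. -/
theorem logHyperfactorial_one : logHyperfactorial 1 = 0 := by
  have h1 := (summable_logGammaTermIntegral (z := 1) (by norm_num)).hasSum.tendsto_sum_nat
  have h0 : Tendsto (fun n : ℕ => ((n : ℝ) + 1) * (Real.log n - Real.log (n + 1))) atTop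
      (𝓝 (-1)) := by
    have h2 : Tendsto (fun n : ℕ => (n : ℝ) * Real.log (1 + 1 / n)) atTop (𝓝 1) :=
      (Real.tendsto_mul_log_one_add_div_atTop 1).comp tendsto_natCast_atTop_atTop
    have := tendsto_log_sub_log_add_one.sub h2
    rw [zero_sub] at this
    refine this.congr' ?_
    filter_upwards [eventually_gt_atTop 0] with n hn
    have hn' : (0 : ℝ) < n := by positivity
    have e : (1 : ℝ) + 1 / n = (n + 1) / n := by field_simp
    rw [e, Real.log_div (by positivity) hn'.ne']
    ring
  have h2 := ((Real.tendsto_harmonic_sub_log.div_const 2).add tendsto_log_factorial_sub).add h0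
  have := tendsto_nhds_unique h1 (h2.congr fun n => ?_)
  · rw [logHyperfactorial, this]
    ring
  · rw [sum_logGammaTermIntegral_one]
    ring

/-- The difference of the two sides has zero derivative by the functional equation of Γ, and it
vanishes at z = 0. -/
theorem logHyperfactorial_add_one {z : ℝ} (hz : 0 ≤ z) :
    logHyperfactorial (z + 1) = logHyperfactorial z + (z + 1) * Real.log (z + 1) := by
  have hd : ∀ w ∈ Ioi (-1 / 2 : ℝ), HasDerivAt (fun w => logHyperfactorial (w + 1) -
      logHyperfactorial w - (w + 1) * Real.log (w + 1)) 0 w := fun w hw => by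
    have hw' : -1 / 2 < w := hw
    have hw1 : 0 < w + 1 := by linarith
    have h1 := (hasDerivAt_logHyperfactorial (z := w + 1) (by linarith)).comp_add_const w 1
    have h2 : HasDerivAt (fun w : ℝ => (w + 1) * Real.log (w + 1)) (Real.log (w + 1) + 1) w :=
      (Real.hasDerivAt_mul_log hw1.ne').comp_add_const w 1
    refine ((h1.sub (hasDerivAt_logHyperfactorial hw')).sub h2).congr_deriv ?_
    rw [Real.Gamma_add_one hw1.ne', Real.log_mul hw1.ne' (Real.Gamma_pos_of_pos hw1).ne']
    ring
  have := isOpen_Ioi.is_const_of_deriv_eq_zero isPreconnected_Ioi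
    (fun w hw => (hd w hw).differentiableAt.differentiableWithinAt)
    (fun w hw => (hd w hw).deriv) (x := z) (y := 0)
    (mem_Ioi.mpr (by linarith)) (mem_Ioi.mpr (by norm_num))
  simp only [zero_add, logHyperfactorial_zero, logHyperfactorial_one, Real.log_one] at this
  linarith

theorem barnesG_add_one_eq_exp {z : ℝ} (hz : 0 ≤ z) :
    barnesG (z + 1) = Real.exp (z * Real.log (Real.Gamma (z + 1)) - logHyperfactorial z) := by
  have hz' : -1 / 2 < z := by linarith
  have h1 := (((summable_logGammaTerm hz').hasSum.mul_left z).sub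
    (summable_logGammaTermIntegral hz').hasSum).rexp
  -- The n-th Weierstrass factor of G is the exponential of z times the log Γ term minus its
  -- antiderivative.
  have e : ∀ n : ℕ, (Real.exp ∘ fun n => z * logGammaTerm n z - logGammaTermIntegral n z) n =
      (1 + z / ((n : ℝ) + 1)) ^ (n + 1) * Real.exp (-z + z ^ 2 / (2 * ((n : ℝ) + 1))) := fun n => by
    have := one_add_div_pos hz' n
    rw [← Real.exp_log (pow_pos (by linarith : 0 < 1 + z / ((n : ℝ) + 1)) (n + 1)), ← Real.exp_add,
      Real.log_pow]
    simp only [Function.comp, logGammaTerm, logGammaTermIntegral]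
    congr 1
    push_cast
    field_simp
    ring
  rw [barnesG]
  simp only [add_sub_cancel_right]
  rw [← tprod_congr e, h1.tprod_eq, Real.rpow_def_of_pos (by positivity), ← Real.exp_add,
    ← Real.exp_add, tsum_logGammaTerm hz', logHyperfactorial]
  congr 1
  ring

theorem barnesG_pos {x : ℝ} (hx : 1 ≤ x) : 0 < barnesG x := by
  have := barnesG_add_one_eq_exp (z := x - 1) (by linarith)
  rw [sub_add_cancel] at this
  rw [this]
  exact Real.exp_pos _

theorem log_barnesG_add_one {z : ℝ} (hz : 0 ≤ z) :
    Real.log (barnesG (z + 1)) = z * Real.log (Real.Gamma (z + 1)) - logHyperfactorial z := by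
  rw [barnesG_add_one_eq_exp hz, Real.log_exp]

theorem barnesG_add_one {x : ℝ} (hx : 1 ≤ x) : barnesG (x + 1) = Real.Gamma x * barnesG x := by
  have hx0 : 0 < x := by linarith
  have h1 := barnesG_add_one_eq_exp (z := x - 1) (by linarith)
  have h2 := logHyperfactorial_add_one (z := x - 1) (by linarith)
  rw [sub_add_cancel] at h1 h2
  have hG := Real.Gamma_pos_of_pos hx0
  rw [barnesG_add_one_eq_exp hx0.le, h1, h2, Real.Gamma_add_one hx0.ne',
    Real.log_mul hx0.ne' hG.ne']
  have e : Real.Gamma x * Real.exp ((x - 1) * Real.log (Real.Gamma x) -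
      logHyperfactorial (x - 1)) = Real.exp (Real.log (Real.Gamma x) +
        ((x - 1) * Real.log (Real.Gamma x) - logHyperfactorial (x - 1))) := by
    rw [Real.exp_add, Real.exp_log hG]
  rw [e]
  congr 1
  ring

theorem barnesG_one : barnesG 1 = 1 := by
  have := barnesG_add_one_eq_exp le_rfl
  simpa [logHyperfactorial_zero] using this

theorem barnesG_add_natCast {x : ℝ} (hx : 1 ≤ x) (n : ℕ) :
    barnesG (x + n) = (∏ j ∈ Finset.range n, Real.Gamma (x + j)) * barnesG x := by
  induction n with
  | zero => simp
  | succ n ih =>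
    have hn : (0 : ℝ) ≤ n := n.cast_nonneg
    push_cast
    rw [← add_assoc, barnesG_add_one (by linarith), ih, Finset.prod_range_succ]
    ring

/-! ### Expansions of log H and log G up to a constant -/

/-- If `h' = O(z ^ (-p-1))` and `h` tends to `c` along the integers, then `h - c = O(z ^ (-p))`. -/
theorem sub_isBigO_of_hasDerivAt {h h' : ℝ → ℝ} {c : ℝ} {p : ℕ} (hp : 1 ≤ p)
    (hd : ∀ z, 0 < z → HasDerivAt h (h' z) z)
    (hO : h' =O[atTop] fun z => 1 / z ^ (p + 1))
    (hc : Tendsto (fun n : ℕ => h n) atTop (𝓝 c)) :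
    (fun z => h z - c) =O[atTop] fun z => 1 / z ^ p := by
  obtain ⟨C, hC⟩ := hO.bound
  obtain ⟨a, ha⟩ := eventually_atTop.mp (hC.and (eventually_gt_atTop 0))
  have hp0 : (0 : ℝ) < p := by exact_mod_cast hp
  have hq : ∀ z, 0 < z → HasDerivAt (fun z : ℝ => C / p * (1 / z ^ p)) (-(C * (1 / z ^ (p + 1)))) z :=
    fun z hz => by
      have := (((hasDerivAt_pow p z).inv (by positivity)).const_mul (C / p))
      simp only [one_div]
      refine this.congr_deriv ?_
      have e : z ^ p = z ^ (p - 1) * z := by rw [← pow_succ]; congr 1; omega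
      field_simp
      rw [pow_succ, e]
      ring
  have hb : ∀ z, a ≤ z → |h' z| ≤ C * (1 / z ^ (p + 1)) := fun z hz => by
    have := ha z hz
    have hz0 := this.2
    rw [Real.norm_eq_abs, Real.norm_of_nonneg (by positivity)] at this
    exact this.1
  have hpos : ∀ z, a ≤ z → 0 < z := fun z hz => (ha z hz).2
  -- Adding or subtracting an antiderivative of the bound makes h monotone, so a limit along the
  -- integers controls h at every real z.
  have hanti : AntitoneOn (fun z => h z + C / p * (1 / z ^ p)) (Ici a) := by
    have hD : ∀ z ∈ Ici a, HasDerivAt (fun z => h z + C / p * (1 / z ^ p)) _ z :=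
      fun z hz => (hd z (hpos z hz)).add (hq z (hpos z hz))
    refine antitoneOn_of_deriv_nonpos (convex_Ici a)
      (fun z hz => (hD z hz).continuousAt.continuousWithinAt)
      (fun z hz => (hD z (interior_subset hz)).differentiableAt.differentiableWithinAt)
      (fun z hz => ?_)
    rw [(hD z (interior_subset hz)).deriv]
    linarith [(abs_le.mp (hb z (interior_subset hz))).2]
  have hmono : MonotoneOn (fun z => h z - C / p * (1 / z ^ p)) (Ici a) := by
    have hD : ∀ z ∈ Ici a, HasDerivAt (fun z => h z - C / p * (1 / z ^ p)) _ z :=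
      fun z hz => (hd z (hpos z hz)).sub (hq z (hpos z hz))
    refine monotoneOn_of_deriv_nonneg (convex_Ici a)
      (fun z hz => (hD z hz).continuousAt.continuousWithinAt)
      (fun z hz => (hD z (interior_subset hz)).differentiableAt.differentiableWithinAt)
      (fun z hz => ?_)
    rw [(hD z (interior_subset hz)).deriv]
    linarith [(abs_le.mp (hb z (interior_subset hz))).1]
  have hlim0 : Tendsto (fun n : ℕ => C / p * (1 / (n : ℝ) ^ p)) atTop (𝓝 0) := by
    have := ((tendsto_pow_atTop (α := ℝ) (n := p) (by omega)).comp
      (tendsto_natCast_atTop_atTop (R := ℝ))).const_div_atTop (C / p)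
    exact this.congr fun n => by simp [div_eq_mul_inv]
  refine IsBigO.of_bound (C / p) ?_
  filter_upwards [eventually_ge_atTop a] with z hz
  have hz0 := hpos z hz
  have hev : ∀ᶠ n : ℕ in atTop, z ≤ (n : ℝ) := tendsto_natCast_atTop_atTop.eventually_ge_atTop z
  have h1 : c + 0 ≤ h z + C / p * (1 / z ^ p) := by
    refine le_of_tendsto (hc.add hlim0) ?_
    filter_upwards [hev] with n hn
    exact hanti hz (hz.trans hn) hn
  have h2 : h z - C / p * (1 / z ^ p) ≤ c - 0 := by
    refine ge_of_tendsto (hc.sub hlim0) ?_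
    filter_upwards [hev] with n hn
    exact hmono hz (hz.trans hn) hn
  rw [Real.norm_eq_abs, Real.norm_of_nonneg (by positivity), abs_le]
  constructor <;> linarith

/-- The asymptotic series of `logHyperfactorial` without its constant term. -/
def hyperfactorialSeries (K : ℕ) (z : ℝ) : ℝ :=
  z ^ 2 / 2 * Real.log z - z ^ 2 / 4 + z / 2 * Real.log z + 1 / 12 * Real.log z -
    ∑ k ∈ Finset.Icc 1 K, (bernoulli (2 * k + 2) : ℝ) / ((2 * k + 2) * (2 * k + 1) * (2 * k)) *
      (1 / z ^ (2 * k))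

/-- The series is the termwise antiderivative of Stirling's series. The B_2 term 1/(12z) integrates
to the logarithm, which shifts the truncation index by one. -/
theorem hasDerivAt_hyperfactorialSeries (K : ℕ) {z : ℝ} (hz : 0 < z) :
    HasDerivAt (hyperfactorialSeries K)
      (stirlingSeries (K + 1) z + z + 1 / 2 - Real.log (2 * Real.pi) / 2) z := by
  induction K with
  | zero =>
    have hl := Real.hasDerivAt_log hz.ne'
    have h := (((((hasDerivAt_pow 2 z).div_const 2).mul hl).sub
      ((hasDerivAt_pow 2 z).div_const 4)).add (((hasDerivAt_id z).div_const 2).mul hl)).add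
      (hl.const_mul (1 / 12))
    have e : hyperfactorialSeries 0 = fun z => z ^ 2 / 2 * Real.log z - z ^ 2 / 4 +
        z / 2 * Real.log z + 1 / 12 * Real.log z := by
      ext z; simp [hyperfactorialSeries]
    rw [e]
    refine h.congr_deriv ?_
    simp [stirlingSeries]
    field_simp
    ring
  | succ K ih =>
    have hn := ((hasDerivAt_pow (2 * (K + 1)) z).inv (by positivity)).const_mul
      ((bernoulli (2 * (K + 1) + 2) : ℝ) / ((2 * (K + 1 : ℕ) + 2) * (2 * (K + 1 : ℕ) + 1) *
        (2 * (K + 1 : ℕ))))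
    have e : hyperfactorialSeries (K + 1) = fun z => hyperfactorialSeries K z -
        (bernoulli (2 * (K + 1) + 2) : ℝ) / ((2 * (K + 1 : ℕ) + 2) * (2 * (K + 1 : ℕ) + 1) *
        (2 * (K + 1 : ℕ))) * (z ^ (2 * (K + 1)))⁻¹ := by
      ext z
      rw [hyperfactorialSeries, Finset.sum_Icc_succ_top (by omega), ← sub_sub,
        ← hyperfactorialSeries, one_div]
    have e2 : stirlingSeries (K + 1 + 1) z = stirlingSeries (K + 1) z +
      (bernoulli (2 * (K + 1 + 1)) : ℝ) / (2 * (K + 1 + 1 : ℕ) * (2 * (K + 1 + 1 : ℕ) - 1)) *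
        (1 / z ^ (2 * (K + 1 + 1) - 1)) := by
      rw [stirlingSeries, Finset.sum_Icc_succ_top (by omega), ← add_assoc, ← stirlingSeries]
    rw [e]
    refine (ih.sub hn).congr_deriv ?_
    rw [e2, show 2 * (K + 1 + 1) - 1 = 2 * K + 3 by omega, show 2 * (K + 1) - 1 = 2 * K + 1 by omega,
      show 2 * (K + 1 + 1) = 2 * (K + 1) + 2 by ring]
    generalize (bernoulli (2 * (K + 1) + 2) : ℝ) = b
    generalize stirlingSeries (K + 1) z = s
    push_cast
    have : 2 * ((K : ℝ) + 1 + 1) - 1 ≠ 0 := by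
      have : (0 : ℝ) ≤ K := K.cast_nonneg
      linarith
    field_simp
    ring

theorem logHyperfactorial_sub_isBigO {c : ℝ} (hc : Tendsto (fun n : ℕ => logHyperfactorial n -
      ((n : ℝ) ^ 2 / 2 * Real.log n - (n : ℝ) ^ 2 / 4 + n / 2 * Real.log n +
        1 / 12 * Real.log n)) atTop (𝓝 c)) (K : ℕ) :
    (fun z => logHyperfactorial z - hyperfactorialSeries K z - c) =O[atTop]
      fun z => 1 / z ^ (2 * K + 2) := by
  refine sub_isBigO_of_hasDerivAt (h := fun z => logHyperfactorial z - hyperfactorialSeries K z)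
    (by omega) (fun z hz => (hasDerivAt_logHyperfactorial (by linarith)).sub
      (hasDerivAt_hyperfactorialSeries K hz)) ?_ ?_
  · exact (log_Gamma_sub_stirlingSeries_isBigO (K + 1)).congr_left fun z => by ring
  · have h0 : Tendsto (fun n : ℕ => ∑ k ∈ Finset.Icc 1 K,
        (bernoulli (2 * k + 2) : ℝ) / ((2 * k + 2) * (2 * k + 1) * (2 * k)) *
          (1 / (n : ℝ) ^ (2 * k))) atTop (𝓝 (∑ k ∈ Finset.Icc 1 K, 0)) := by
      refine tendsto_finsetSum _ fun k hk => ?_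
      have hk1 := (Finset.mem_Icc.mp hk).1
      have := ((tendsto_pow_atTop (α := ℝ) (n := 2 * k) (by omega)).comp
        (tendsto_natCast_atTop_atTop (R := ℝ))).const_div_atTop
        ((bernoulli (2 * k + 2) : ℝ) / ((2 * k + 2) * (2 * k + 1) * (2 * k)))
      exact this.congr fun n => by rw [Function.comp_apply, mul_one_div]
    rw [Finset.sum_const_zero] at h0
    have := hc.add h0
    rw [add_zero] at this
    refine this.congr fun n => ?_
    rw [hyperfactorialSeries]
    ring

/-- The asymptotic series of `log G (z + 1)` without its constant term. -/
def barnesSeries (K : ℕ) (z : ℝ) : ℝ :=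
  z ^ 2 / 2 * Real.log z - 3 / 4 * z ^ 2 + z / 2 * Real.log (2 * Real.pi) - 1 / 12 * Real.log z +
    ∑ k ∈ Finset.Icc 1 K, (bernoulli (2 * k + 2) : ℝ) / (4 * k * (k + 1)) * (1 / z ^ (2 * k))

/-- Coefficients combine by 1/((2k+2)(2k+1)) · (1 + 1/(2k)) = 1/(4k(k+1)). The 1/12 is z times the
B_2 term of Stirling's series. -/
theorem mul_stirlingSeries_sub_hyperfactorialSeries (K : ℕ) {z : ℝ} (hz : 0 < z) :
    z * stirlingSeries (K + 1) z - hyperfactorialSeries K z = barnesSeries K z + 1 / 12 := by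
  induction K with
  | zero =>
    simp [stirlingSeries, hyperfactorialSeries, barnesSeries]
    field_simp
    ring
  | succ K ih =>
    rw [hyperfactorialSeries, Finset.sum_Icc_succ_top (by omega), ← sub_sub,
      ← hyperfactorialSeries, barnesSeries, Finset.sum_Icc_succ_top (by omega), ← add_assoc,
      ← barnesSeries, stirlingSeries, Finset.sum_Icc_succ_top (by omega), ← add_assoc,
      ← stirlingSeries, show 2 * (K + 1 + 1) - 1 = 2 * K + 3 by omega,
      show 2 * (K + 1 + 1) = 2 * (K + 1) + 2 by ring, ← sub_eq_zero]
    rw [← sub_eq_zero] at ih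
    refine Eq.trans ?_ ih
    generalize (bernoulli (2 * (K + 1) + 2) : ℝ) = b
    push_cast
    have : 2 * ((K : ℝ) + 1 + 1) - 1 ≠ 0 := by
      have : (0 : ℝ) ≤ K := K.cast_nonneg
      linarith
    field_simp
    ring

theorem log_barnesG_sub_isBigO {c : ℝ} (hc : Tendsto (fun n : ℕ => logHyperfactorial n -
      ((n : ℝ) ^ 2 / 2 * Real.log n - (n : ℝ) ^ 2 / 4 + n / 2 * Real.log n +
        1 / 12 * Real.log n)) atTop (𝓝 c)) (K : ℕ) :
    (fun z => Real.log (barnesG (z + 1)) - (barnesSeries K z + (1 / 12 - c))) =O[atTop]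
      fun z => 1 / z ^ (2 * K + 2) := by
  have h1 := (isBigO_refl (fun z : ℝ => z) atTop).mul (log_Gamma_sub_stirlingSeries_isBigO (K + 1))
  have h2 : (fun z : ℝ => z * (1 / z ^ (2 * (K + 1) + 1))) =ᶠ[atTop]
      fun z => 1 / z ^ (2 * K + 2) := by
    filter_upwards [eventually_gt_atTop 0] with z hz
    rw [show 2 * (K + 1) + 1 = 2 * K + 2 + 1 by ring, pow_succ]
    field_simp
  refine ((h1.trans_eventuallyEq h2).sub (logHyperfactorial_sub_isBigO hc K)).congr' ?_ .rfl
  filter_upwards [eventually_gt_atTop 0] with z hz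
  rw [log_barnesG_add_one hz.le, ← sub_eq_zero]
  have := mul_stirlingSeries_sub_hyperfactorialSeries K hz
  linear_combination -this

/-! ### The Glaisher–Kinkelin constant and ζ'(-1) -/

/-- `-x ^ (1 - s)` and its iterated derivatives in `x`. -/
def cpowDerivSeq (s : ℂ) (k : ℕ) (x : ℝ) : ℂ :=
  -(∏ j ∈ Finset.range k, (1 - s - j)) * (x : ℂ) ^ (1 - s - k)

theorem hasDerivAt_cpowDerivSeq (s : ℂ) (k : ℕ) {x : ℝ} (hx : 0 < x) :
    HasDerivAt (cpowDerivSeq s k) (cpowDerivSeq s (k + 1) x) x := by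
  have h0 : HasDerivAt (fun y : ℂ => y ^ (1 - s - k)) ((1 - s - k) * (x : ℂ) ^ (1 - s - k - 1)) x := by
    simpa using (hasDerivAt_id (x : ℂ)).cpow_const (c := 1 - s - k) (Or.inl hx)
  have h := (h0.comp_ofReal).const_mul (-(∏ j ∈ Finset.range k, (1 - s - j)))
  refine h.congr_deriv ?_
  rw [cpowDerivSeq, Finset.prod_range_succ]
  push_cast
  rw [← sub_sub]
  ring

/-- The Euler--Maclaurin antidifference of `(s - 1) x ^ (-s)`, truncated after two correction
terms. -/
def zetaAntidifference (x : ℝ) (s : ℂ) : ℂ :=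
  -(x : ℂ) ^ (1 - s) + (s - 1) / 2 * (x : ℂ) ^ (-s) + s * (1 - s) / 12 * (x : ℂ) ^ (-1 - s)

/-- The `n`-th term of a series for `(s - 1) ζ(s)` which converges for `Re s > -2`. -/
def zetaTerm (n : ℕ) (s : ℂ) : ℂ :=
  (s - 1) * ((n + 2 : ℝ) : ℂ) ^ (-s) -
    (zetaAntidifference (n + 2) s - zetaAntidifference (n + 1) s)

theorem sum_cpowDerivSeq (x : ℝ) (s : ℂ) :
    ∑ k ∈ Finset.range 4, ((bernoulli' k : ℝ) / k.factorial) • cpowDerivSeq s k x =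
      zetaAntidifference x s := by
  simp only [Finset.sum_range_succ, Finset.prod_range_succ, Finset.sum_range_zero, bernoulli'_zero, bernoulli'_one,
    bernoulli'_two, bernoulli'_three, cpowDerivSeq, zetaAntidifference, Finset.prod_range_zero,
    Complex.real_smul, Nat.factorial]
  push_cast
  rw [show 1 - s - 0 = 1 - s by ring, show 1 - s - 1 = -s by ring, show 1 - s - 2 = -1 - s by ring]
  ring

/-- The remainder involves a fourth derivative of size x^(-3-Re s), at most x^(-3/2) here, hence
summable. The 7 bounds |1-s-j| for |s| ≤ 3 and j ≤ 3. -/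
theorem exists_zetaTerm_bound : ∃ C : ℝ, ∀ (n : ℕ) (s : ℂ), -3 / 2 ≤ s.re → ‖s‖ ≤ 3 →
    ‖zetaTerm n s‖ ≤ C * (1 / ((n : ℝ) + 1) ^ (3 / 2 : ℝ)) := by
  obtain ⟨C, hC0, hC⟩ := exists_eulerMaclaurin_bound 2
  refine ⟨C * 7 ^ 4, fun n s hs hs3 => ?_⟩
  have h := hC (f := fun k x => cpowDerivSeq s k (n + 1 + x)) (fun k x hx =>
    HasDerivAt.comp_const_add ((n : ℝ) + 1) x (hasDerivAt_cpowDerivSeq s k (by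
      have : (0 : ℝ) ≤ n := n.cast_nonneg
      linarith [hx.1]))) (7 ^ 4 * (1 / ((n : ℝ) + 1) ^ (3 / 2 : ℝ))) (fun x hx => by
    have hn : (0 : ℝ) ≤ n := n.cast_nonneg
    have hx0 := hx.1
    have hpos : 0 < (n : ℝ) + 1 + x := by linarith
    rw [cpowDerivSeq, norm_mul, norm_neg, norm_prod, Complex.norm_cpow_eq_rpow_re_of_pos hpos]
    have h1 : ∏ j ∈ Finset.range (2 + 2), ‖1 - s - (j : ℂ)‖ ≤
        ∏ j ∈ Finset.range (2 + 2), (7 : ℝ) := by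
      refine Finset.prod_le_prod (fun _ _ => norm_nonneg _) fun j hj => ?_
      have hj' : (j : ℝ) ≤ 3 := by
        have := Finset.mem_range.mp hj
        exact_mod_cast (by omega : j ≤ 3)
      calc ‖1 - s - (j : ℂ)‖ ≤ ‖1 - s‖ + ‖(j : ℂ)‖ := norm_sub_le _ _
        _ ≤ ‖(1 : ℂ)‖ + ‖s‖ + ‖(j : ℂ)‖ := by gcongr; exact norm_sub_le _ _
        _ ≤ 7 := by rw [norm_one, Complex.norm_natCast]; linarith
    have h2 : ((n : ℝ) + 1 + x) ^ (1 - s - ((2 + 2 : ℕ) : ℂ)).re ≤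
        1 / ((n : ℝ) + 1) ^ (3 / 2 : ℝ) := by
      rw [one_div, ← Real.rpow_neg (by positivity)]
      calc ((n : ℝ) + 1 + x) ^ (1 - s - ((2 + 2 : ℕ) : ℂ)).re
          ≤ ((n : ℝ) + 1 + x) ^ (-(3 / 2) : ℝ) := by
            refine Real.rpow_le_rpow_of_exponent_le (by linarith) ?_
            simp
            linarith
        _ ≤ _ := Real.rpow_le_rpow_of_nonpos (by positivity) (by linarith) (by norm_num)
    refine mul_le_mul (h1.trans (by simp)) h2 (by positivity) (by positivity))
  rw [mul_assoc]
  refine le_of_eq_of_le ?_ h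
  simp only [smul_sub, Finset.sum_sub_distrib, show 2 + 2 = 4 from rfl, sum_cpowDerivSeq]
  rw [zetaTerm]
  congr 2
  · rw [cpowDerivSeq]
    push_cast
    rw [show 1 - s - 1 = -s by ring, show (n : ℂ) + 1 + 1 = n + 2 by ring]
    simp
  · rw [add_zero, show (n : ℝ) + 1 + 1 = n + 2 by ring]

theorem hasDerivAt_zetaAntidifference {x : ℝ} (hx : 0 < x) (s : ℂ) :
    HasDerivAt (zetaAntidifference x)
      (Real.log x * (x : ℂ) ^ (1 - s) + (1 / 2 * (x : ℂ) ^ (-s) -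
        (s - 1) / 2 * (Real.log x * (x : ℂ) ^ (-s))) + ((1 - 2 * s) / 12 * (x : ℂ) ^ (-1 - s) -
        s * (1 - s) / 12 * (Real.log x * (x : ℂ) ^ (-1 - s)))) s := by
  have hx0 : (x : ℂ) ≠ 0 := by exact_mod_cast hx.ne'
  have hp : ∀ {u : ℂ → ℂ}, HasDerivAt u (-1) s →
      HasDerivAt (fun s => (x : ℂ) ^ u s) (-(Real.log x * (x : ℂ) ^ u s)) s := fun hu => by
    refine (hu.const_cpow (Or.inl hx0)).congr_deriv ?_
    rw [Complex.ofReal_log hx.le]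
    ring
  have h1 := hp ((hasDerivAt_id s).const_sub 1)
  have h2 := hp (hasDerivAt_id s).neg
  have h3 := hp ((hasDerivAt_id s).const_sub (-1))
  have hid := hasDerivAt_id s
  have := (h1.neg.add (((hid.sub_const 1).div_const 2).mul h2)).add
    (((hid.mul (hid.const_sub 1)).div_const 12).mul h3)
  refine this.congr_deriv ?_
  simp only [id, Pi.neg_apply, Pi.mul_apply]
  ring

theorem hasDerivAt_zetaTerm (n : ℕ) (s : ℂ) :
    HasDerivAt (zetaTerm n) (((n + 2 : ℝ) : ℂ) ^ (-s) -
      (s - 1) * (Real.log (n + 2) * ((n + 2 : ℝ) : ℂ) ^ (-s)) -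
      (deriv (zetaAntidifference (n + 2)) s - deriv (zetaAntidifference (n + 1)) s)) s := by
  have hx : (0 : ℝ) < n + 2 := by positivity
  have hx0 : ((n + 2 : ℝ) : ℂ) ≠ 0 := by exact_mod_cast hx.ne'
  have h1 := (hasDerivAt_id s).neg.const_cpow (c := ((n + 2 : ℝ) : ℂ)) (Or.inl hx0)
  have := (((hasDerivAt_id s).sub_const 1).mul h1).sub
    ((hasDerivAt_zetaAntidifference hx s).differentiableAt.hasDerivAt.sub
    (hasDerivAt_zetaAntidifference (x := n + 1) (by positivity) s).differentiableAt.hasDerivAt)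
  refine this.congr_deriv ?_
  rw [Complex.ofReal_log hx.le]
  simp only [id, Pi.neg_apply]
  ring

theorem sum_zetaTerm (s : ℂ) (N : ℕ) :
    ∑ n ∈ Finset.range N, zetaTerm n s =
      (s - 1) * ∑ n ∈ Finset.range N, ((n + 2 : ℝ) : ℂ) ^ (-s) -
        (zetaAntidifference (N + 1) s - zetaAntidifference 1 s) := by
  have h := Finset.sum_range_sub (fun n : ℕ => zetaAntidifference ((n : ℝ) + 1) s) N
  simp only [Nat.cast_zero, zero_add] at h
  rw [← h, Finset.mul_sum, ← Finset.sum_sub_distrib]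
  refine Finset.sum_congr rfl fun n _ => ?_
  rw [zetaTerm]
  push_cast
  rw [show (n : ℝ) + 1 + 1 = n + 2 by ring]

theorem tendsto_zetaAntidifference {s : ℂ} (hs : 1 < s.re) :
    Tendsto (fun N : ℕ => zetaAntidifference (N + 1) s) atTop (𝓝 0) := by
  have hc : ∀ {w : ℂ}, w.re < 0 →
      Tendsto (fun N : ℕ => ((N + 1 : ℝ) : ℂ) ^ w) atTop (𝓝 0) := fun {w} hw => by
    rw [tendsto_zero_iff_norm_tendsto_zero]
    have h1 := (tendsto_rpow_neg_atTop (y := -w.re) (by linarith)).comp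
      (tendsto_atTop_add_const_right atTop (1 : ℝ) tendsto_natCast_atTop_atTop)
    refine h1.congr fun N => ?_
    rw [Complex.norm_cpow_eq_rpow_re_of_pos (by positivity)]
    simp
  have := (((hc (w := 1 - s) (by simp; linarith)).neg).add
    ((hc (w := -s) (by simp; linarith)).const_mul ((s - 1) / 2))).add
    ((hc (w := -1 - s) (by simp; linarith)).const_mul (s * (1 - s) / 12))
  simpa [zetaAntidifference] using this

theorem tsum_zetaTerm_of_one_lt_re {s : ℂ} (hs : 1 < s.re) (hsum : Summable (zetaTerm · s)) :
    ∑' n, zetaTerm n s = (s - 1) * (riemannZeta s - 1) + zetaAntidifference 1 s := by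
  have h1 : Summable fun n : ℕ => 1 / ((n : ℂ) + 1) ^ s := by
    simpa using (summable_nat_add_iff 1).mpr (Complex.summable_one_div_nat_cpow.mpr hs)
  have h2 : HasSum (fun n : ℕ => 1 / ((n : ℂ) + 1) ^ s) (riemannZeta s) := by
    rw [zeta_eq_tsum_one_div_nat_add_one_cpow hs]
    exact h1.hasSum
  have h3 := ((hasSum_nat_add_iff' 1).mpr h2).tendsto_sum_nat
  have h4 := (h3.const_mul (s - 1)).sub ((tendsto_zetaAntidifference hs).sub_const
    (zetaAntidifference 1 s))
  have := tendsto_nhds_unique hsum.hasSum.tendsto_sum_nat (h4.congr fun N => ?_)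
  · rw [this]
    simp
  · rw [sum_zetaTerm]
    congr 2
    refine Finset.sum_congr rfl fun n _ => ?_
    push_cast
    rw [Complex.cpow_neg, one_div, show (n : ℂ) + 1 + 1 = n + 2 by ring]

/-- A disc containing `-1` and points with real part greater than `1`, but not `1`. -/
def zetaDisc : Set ℂ := Metric.ball ⟨-1 / 10, 4 / 5⟩ (13 / 10)

theorem mem_zetaDisc {s : ℂ} :
    s ∈ zetaDisc ↔ (s.re + 1 / 10) ^ 2 + (s.im - 4 / 5) ^ 2 < (13 / 10) ^ 2 := by
  rw [zetaDisc, Metric.mem_ball, dist_eq_norm, Complex.norm_eq_sqrt_sq_add_sq,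
    Real.sqrt_lt' (by norm_num)]
  simp only [Complex.sub_re, Complex.sub_im]
  norm_num

theorem re_and_norm_of_mem_zetaDisc {s : ℂ} (hs : s ∈ zetaDisc) :
    -3 / 2 ≤ s.re ∧ ‖s‖ ≤ 3 ∧ s ≠ 1 := by
  rw [mem_zetaDisc] at hs
  have h1 : -3 / 2 ≤ s.re := by nlinarith [sq_nonneg (s.im - 4 / 5)]
  refine ⟨h1, ?_, ?_⟩
  · rw [Complex.norm_eq_sqrt_sq_add_sq, Real.sqrt_le_iff]
    constructor
    · norm_num
    · nlinarith [sq_nonneg (s.im - 4 / 5), sq_nonneg (s.re + 1 / 10), sq_nonneg (s.re - 1),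
        sq_nonneg (s.im - 2), sq_nonneg (s.re + 2)]
  · rintro rfl
    norm_num at hs

theorem exists_summable_zetaTerm_bound :
    ∃ u : ℕ → ℝ, Summable u ∧ ∀ (n : ℕ) (w : ℂ), w ∈ zetaDisc → ‖zetaTerm n w‖ ≤ u n := by
  obtain ⟨C, hC⟩ := exists_zetaTerm_bound
  refine ⟨fun n : ℕ => C * (1 / ((n : ℝ) + 1) ^ (3 / 2 : ℝ)), Summable.mul_left C ?_,
    fun n w hw => hC n w (re_and_norm_of_mem_zetaDisc hw).1 (re_and_norm_of_mem_zetaDisc hw).2.1⟩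
  simpa using (summable_nat_add_iff 1).mpr
    (Real.summable_one_div_nat_rpow.mpr (by norm_num : (1 : ℝ) < 3 / 2))

theorem isOpen_zetaDisc : IsOpen zetaDisc := Metric.isOpen_ball

theorem differentiableOn_zetaTerm (n : ℕ) : DifferentiableOn ℂ (zetaTerm n) zetaDisc :=
  fun s _ => (hasDerivAt_zetaTerm n s).differentiableAt.differentiableWithinAt

/-- Both sides are analytic on the disc, the left by uniform summability. They agree near a point
with Re s > 1, and the identity theorem carries this to -1; the disc avoids the pole at 1. -/
theorem tsum_zetaTerm_eq {s : ℂ} (hs : s ∈ zetaDisc) :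
    ∑' n, zetaTerm n s = (s - 1) * (riemannZeta s - 1) + zetaAntidifference 1 s := by
  obtain ⟨u, hsum, hle⟩ := exists_summable_zetaTerm_bound
  have hopen := isOpen_zetaDisc
  have h1 : DifferentiableOn ℂ (fun s => ∑' n, zetaTerm n s) zetaDisc :=
    Complex.differentiableOn_tsum_of_summable_norm hsum differentiableOn_zetaTerm hopen hle
  have h2 : DifferentiableOn ℂ
      (fun s => (s - 1) * (riemannZeta s - 1) + zetaAntidifference 1 s) zetaDisc := fun s hs => by
    have hz := differentiableAt_riemannZeta (re_and_norm_of_mem_zetaDisc hs).2.2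
    exact (((differentiableAt_id.sub_const 1).mul (hz.sub_const 1)).add
      (hasDerivAt_zetaAntidifference one_pos s).differentiableAt).differentiableWithinAt
  refine (h1.analyticOnNhd hopen).eqOn_of_preconnected_of_eventuallyEq (h2.analyticOnNhd hopen)
    (convex_ball _ _).isPreconnected (z₀ := ⟨11 / 10, 4 / 5⟩) (by rw [mem_zetaDisc]; norm_num)
    ?_ hs
  have hV : IsOpen (zetaDisc ∩ {s : ℂ | 1 < s.re}) :=
    hopen.inter (isOpen_lt continuous_const Complex.continuous_re)
  filter_upwards [hV.mem_nhds (x := ⟨11 / 10, 4 / 5⟩)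
    ⟨by rw [mem_zetaDisc]; norm_num, by simp; norm_num⟩] with w hw
  exact tsum_zetaTerm_of_one_lt_re hw.2 (Summable.of_norm_bounded hsum fun n => hle n w hw.1)

theorem neg_one_mem_zetaDisc : (-1 : ℂ) ∈ zetaDisc := by
  rw [mem_zetaDisc]; norm_num

theorem deriv_zetaAntidifference_neg_one {x : ℝ} (hx : 0 < x) :
    deriv (zetaAntidifference x) (-1) =
      ((x ^ 2 * Real.log x + x / 2 + x * Real.log x + 1 / 4 + Real.log x / 6 : ℝ) : ℂ) := by
  rw [(hasDerivAt_zetaAntidifference hx (-1)).deriv, show (1 - -1 : ℂ) = (2 : ℕ) by norm_num,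
    show (-1 - -1 : ℂ) = 0 by norm_num, neg_neg, Complex.cpow_natCast, Complex.cpow_one,
    Complex.cpow_zero]
  push_cast
  ring

theorem riemannZeta_neg_one : riemannZeta (-1) = -1 / 12 := by
  have := riemannZeta_neg_nat_eq_bernoulli' 1
  simp only [Nat.cast_one, Nat.reduceAdd, bernoulli'_two] at this
  rw [this]
  norm_num

/-- Locally uniform convergence permits termwise differentiation; the -1/3 is ζ(-1) - 1 + 3/4. -/
theorem hasSum_deriv_zetaTerm :
    HasSum (fun n => deriv (zetaTerm n) (-1)) (-2 * deriv riemannZeta (-1) - 1 / 3) := by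
  obtain ⟨u, hsum, hle⟩ := exists_summable_zetaTerm_bound
  have h := Complex.hasSum_deriv_of_summable_norm hsum differentiableOn_zetaTerm isOpen_zetaDisc hle
    neg_one_mem_zetaDisc
  have he : (fun s => ∑' n, zetaTerm n s) =ᶠ[𝓝 (-1)]
      fun s => (s - 1) * (riemannZeta s - 1) + zetaAntidifference 1 s := by
    filter_upwards [isOpen_zetaDisc.mem_nhds neg_one_mem_zetaDisc] with s hs
    exact tsum_zetaTerm_eq hs
  have hz := (differentiableAt_riemannZeta (s := -1) (by norm_num)).hasDerivAt
  have hd : HasDerivAt (fun s => (s - 1) * (riemannZeta s - 1) + zetaAntidifference 1 s) _ (-1) :=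
    (((hasDerivAt_id (-1 : ℂ)).sub_const 1).mul (hz.sub_const 1)).add
    (hasDerivAt_zetaAntidifference one_pos (-1)).differentiableAt.hasDerivAt
  rw [he.deriv_eq, hd.deriv, deriv_zetaAntidifference_neg_one one_pos] at h
  convert! h using 1
  simp only [id, riemannZeta_neg_one, Real.log_one]
  push_cast
  ring

/-- At s = -1 the derivative of (s-1)k^(-s) is k + 2k log k, whose logarithmic part sums to twice
log H; the antidifferences telescope to the main terms. -/
theorem sum_deriv_zetaTerm (N : ℕ) :
    ∑ n ∈ Finset.range N, deriv (zetaTerm n) (-1) =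
      ((2 * (logHyperfactorial (N + 1 : ℕ) - (((N + 1 : ℕ) : ℝ) ^ 2 / 2 * Real.log (N + 1 : ℕ) -
        ((N + 1 : ℕ) : ℝ) ^ 2 / 4 + (N + 1 : ℕ) / 2 * Real.log (N + 1 : ℕ) +
        1 / 12 * Real.log (N + 1 : ℕ))) - 1 / 2 : ℝ) : ℂ) := by
  have hterm : ∀ n : ℕ, deriv (zetaTerm n) (-1) =
      (((n + 2 : ℝ) + 2 * ((n + 2) * Real.log (n + 2)) : ℝ) : ℂ) -
      (deriv (zetaAntidifference (n + 2)) (-1) - deriv (zetaAntidifference (n + 1)) (-1)) :=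
    fun n => by
      rw [(hasDerivAt_zetaTerm n (-1)).deriv, neg_neg, Complex.cpow_one]
      push_cast
      ring
  have hx : ∀ n : ℕ, (0 : ℝ) < n + 1 := fun n => by positivity
  induction N with
  | zero =>
    have := logHyperfactorial_one
    simp [this]
    norm_num
  | succ N ih =>
    have hl := logHyperfactorial_add_one (z := N + 1) (hx N).le
    rw [Finset.sum_range_succ, ih, hterm, deriv_zetaAntidifference_neg_one (by positivity),
      deriv_zetaAntidifference_neg_one (hx N)]
    norm_cast
    push_cast
    rw [hl, show (N : ℝ) + 1 + 1 = N + 2 by ring]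
    ring

/-- The Glaisher--Kinkelin constant in terms of the Riemann zeta function. -/
theorem tendsto_logHyperfactorial_sub : Tendsto (fun n : ℕ => logHyperfactorial n -
      ((n : ℝ) ^ 2 / 2 * Real.log n - (n : ℝ) ^ 2 / 4 + n / 2 * Real.log n +
        1 / 12 * Real.log n)) atTop (𝓝 (1 / 12 - (deriv riemannZeta (-1)).re)) := by
  have h := (Complex.continuous_re.tendsto _).comp hasSum_deriv_zetaTerm.tendsto_sum_nat
  have h2 := (h.add_const (1 / 2)).div_const 2
  rw [← tendsto_add_atTop_iff_nat 1]
  have e : ((-2 * deriv riemannZeta (-1) - 1 / 3 : ℂ).re + 1 / 2) / 2 =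
      1 / 12 - (deriv riemannZeta (-1)).re := by
    simp
    ring
  rw [e] at h2
  refine h2.congr fun N => ?_
  rw [Function.comp_apply, sum_deriv_zetaTerm, Complex.ofReal_re]
  ring

/-! ### Partition functions and orthogonal polynomials -/

theorem prod_norm_sub_sq_eq {N : ℕ} (p : ℕ → Polynomial ℂ) (hmonic : ∀ j, (p j).Monic)
    (hdeg : ∀ j, (p j).natDegree = j) (z : Fin N → ℂ) :
    ((∏ j : Fin N, ∏ k ∈ Finset.Ioi j, ‖z j - z k‖ ^ 2 : ℝ) : ℂ) =
      ∑ σ : Equiv.Perm (Fin N), ∑ ρ : Equiv.Perm (Fin N),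
        ((Equiv.Perm.sign σ : ℤ) : ℂ) * ((Equiv.Perm.sign ρ : ℤ) : ℂ) *
          ∏ i, ((p (σ i)).eval (z i) * conj ((p (ρ i)).eval (z i))) := by
  -- Replacing powers by monic polynomials of the same degrees is a unipotent change of basis, so
  -- the determinant is unchanged.
  have hV : (Matrix.vandermonde z).det =
      ∑ σ : Equiv.Perm (Fin N), ((Equiv.Perm.sign σ : ℤ) : ℂ) * ∏ i, (p (σ i)).eval (z i) := by
    rw [Matrix.det_eval_matrixOfPolynomials_eq_det_vandermonde z (fun j => p j)
      (fun j => hdeg j) (fun j => hmonic j), ← Matrix.det_transpose, Matrix.det_apply']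
    rfl
  have hn : ((∏ j : Fin N, ∏ k ∈ Finset.Ioi j, ‖z j - z k‖ ^ 2 : ℝ) : ℂ) =
      (Matrix.vandermonde z).det * conj (Matrix.vandermonde z).det := by
    rw [Matrix.det_vandermonde]
    push_cast
    simp only [map_prod, ← Finset.prod_mul_distrib, Complex.mul_conj']
    refine Finset.prod_congr rfl fun j _ => Finset.prod_congr rfl fun k _ => ?_
    rw [norm_sub_rev]
  rw [hn, hV, map_sum, Finset.sum_mul_sum]
  refine Finset.sum_congr rfl fun σ _ => Finset.sum_congr rfl fun ρ _ => ?_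
  rw [map_mul, map_prod, Finset.prod_mul_distrib]
  simp only [map_intCast]
  ring

/-- The integral of a squared Vandermonde determinant against a product weight, in terms of the
squared norms of the monic orthogonal polynomials of the weight. -/
theorem integral_prod_norm_sub_sq (μ : Measure ℂ) [SigmaFinite μ] (w : ℂ → ℝ)
    (p : ℕ → Polynomial ℂ) (hmonic : ∀ j, (p j).Monic) (hdeg : ∀ j, (p j).natDegree = j) (h : ℕ → ℝ)
    (hint : ∀ j k, Integrable (fun z => (p j).eval z * conj ((p k).eval z) * (w z : ℂ)) μ)
    (horth : ∀ j k, ∫ z, (p j).eval z * conj ((p k).eval z) * (w z : ℂ) ∂μ =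
      if j = k then (h j : ℂ) else 0) (N : ℕ) :
    ∫ z : Fin N → ℂ, (∏ j : Fin N, ∏ k ∈ Finset.Ioi j, ‖z j - z k‖ ^ 2) * ∏ j, w (z j)
      ∂(Measure.pi fun _ => μ) = N.factorial * ∏ j ∈ Finset.range N, h j := by
  apply Complex.ofReal_injective
  rw [← integral_complex_ofReal]
  have hrw : ∀ z : Fin N → ℂ,
      (((∏ j : Fin N, ∏ k ∈ Finset.Ioi j, ‖z j - z k‖ ^ 2) * ∏ j, w (z j) : ℝ) : ℂ) =
      ∑ σ : Equiv.Perm (Fin N), ∑ ρ : Equiv.Perm (Fin N),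
        ((Equiv.Perm.sign σ : ℤ) : ℂ) * ((Equiv.Perm.sign ρ : ℤ) : ℂ) *
          ∏ i, ((p (σ i)).eval (z i) * conj ((p (ρ i)).eval (z i)) * (w (z i) : ℂ)) := by
    intro z
    rw [Complex.ofReal_mul, prod_norm_sub_sq_eq p hmonic hdeg, Finset.sum_mul]
    refine Finset.sum_congr rfl fun σ _ => ?_
    rw [Finset.sum_mul]
    refine Finset.sum_congr rfl fun ρ _ => ?_
    rw [Finset.prod_mul_distrib (g := fun i => (w (z i) : ℂ)), Complex.ofReal_prod, mul_assoc]
  have hI : ∀ σ ρ : Equiv.Perm (Fin N), Integrable (fun z : Fin N → ℂ =>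
      ((Equiv.Perm.sign σ : ℤ) : ℂ) * ((Equiv.Perm.sign ρ : ℤ) : ℂ) *
          ∏ i, ((p (σ i)).eval (z i) * conj ((p (ρ i)).eval (z i)) * (w (z i) : ℂ)))
      (Measure.pi fun _ => μ) := fun σ ρ =>
    (Integrable.fintype_prod (f := fun (i : Fin N) (z : ℂ) =>
      (p (σ i)).eval z * conj ((p (ρ i)).eval z) * (w z : ℂ)) fun i => hint _ _).const_mul _
  simp only [hrw]
  rw [integral_finsetSum _ fun σ _ => integrable_finsetSum _ fun ρ _ => hI σ ρ]
  -- By Fubini the integral factors over the coordinates. If ρ ≠ σ, some coordinate pairs two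
  -- orthogonal polynomials and the term dies.
  have hσ : ∀ σ : Equiv.Perm (Fin N), ∫ z : Fin N → ℂ, ∑ ρ : Equiv.Perm (Fin N),
      ((Equiv.Perm.sign σ : ℤ) : ℂ) * ((Equiv.Perm.sign ρ : ℤ) : ℂ) *
          ∏ i, ((p (σ i)).eval (z i) * conj ((p (ρ i)).eval (z i)) * (w (z i) : ℂ))
      ∂(Measure.pi fun _ => μ) = ∏ j : Fin N, (h j : ℂ) := fun σ => by
    rw [integral_finsetSum _ fun ρ _ => hI σ ρ, Finset.sum_eq_single σ]
    · rw [integral_const_mul, integral_fintype_prod_eq_prod (fun (i : Fin N) (z : ℂ) =>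
        (p (σ i)).eval z * conj ((p (σ i)).eval z) * (w z : ℂ))]
      simp only [horth, if_true]
      rw [Equiv.prod_comp σ (fun j : Fin N => (h j : ℂ)), ← Int.cast_mul, ← Units.val_mul,
        Int.units_mul_self]
      simp
    · intro ρ _ hρ
      rw [integral_const_mul, integral_fintype_prod_eq_prod (fun (i : Fin N) (z : ℂ) =>
        (p (σ i)).eval z * conj ((p (ρ i)).eval z) * (w z : ℂ))]
      obtain ⟨i, hi⟩ : ∃ i, σ i ≠ ρ i := by
        by_contra! hc
        exact hρ (Equiv.ext hc).symm
      rw [Finset.prod_eq_zero (Finset.mem_univ i), mul_zero]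
      rw [horth, if_neg]
      exact fun he => hi (Fin.ext he)
    · simp
  rw [Finset.sum_congr rfl fun σ _ => hσ σ, Finset.sum_const, Finset.card_univ, Fintype.card_perm,
    Fintype.card_fin, nsmul_eq_mul, Finset.prod_range]
  push_cast
  rfl

/-! ### The induced Ginibre potential -/

instance : SigmaFinite areaMeasure := by
  rw [areaMeasure, ← withDensity_const]
  exact SigmaFinite.withDensity_of_ne_top (ae_of_all _ fun _ => ENNReal.ofReal_ne_top)

theorem integral_areaMeasure (f : ℂ → ℂ) :
    ∫ z, f z ∂areaMeasure = (Real.pi : ℂ)⁻¹ * ∫ z, f z := by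
  rw [areaMeasure, integral_smul_measure, ENNReal.toReal_ofReal (by positivity), Complex.real_smul]
  push_cast
  rfl

theorem integrable_areaMeasure {f : ℂ → ℂ} (hf : Integrable f) : Integrable f areaMeasure :=
  hf.smul_measure ENNReal.ofReal_ne_top

theorem integrable_norm_rpow_mul_exp {q b : ℝ} (hq : 0 ≤ q) (hb : 0 < b) :
    Integrable fun z : ℂ => ‖z‖ ^ q * Real.exp (-b * ‖z‖ ^ (2 : ℝ)) := by
  -- A nonintegrable function has Bochner integral 0, so the nonzero closed form already proves
  -- integrability.
  refine Integrable.of_integral_ne_zero ?_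
  rw [Complex.integral_rpow_mul_exp_neg_mul_rpow one_le_two (by linarith) hb]
  have := Real.Gamma_pos_of_pos (s := (q + 2) / 2) (by linarith)
  positivity

/-- Rotation by the angle π/(j-k) preserves the measure and changes the sign of the integrand. -/
theorem integral_pow_mul_conj_pow_eq_zero {j k : ℕ} (hjk : j ≠ k) (W : ℝ → ℝ) :
    ∫ z : ℂ, z ^ j * conj (z ^ k) * (W ‖z‖ : ℂ) = 0 := by
  have hne : ((j : ℂ) - k) ≠ 0 := sub_ne_zero.mpr (by exact_mod_cast hjk)
  let u : Circle := Circle.exp (Real.pi / (j - k))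
  have hu : (u : ℂ) ^ j * conj ((u : ℂ) ^ k) = -1 := by
    rw [Circle.coe_exp, ← Complex.exp_nat_mul, ← Complex.exp_nat_mul, ← Complex.exp_conj,
      ← Complex.exp_add, ← Complex.exp_pi_mul_I]
    congr 1
    simp only [map_mul, Complex.conj_ofReal, Complex.conj_I, Complex.conj_natCast]
    push_cast
    field_simp
    ring
  have h := ((rotation u).measurePreserving).integral_comp
    (rotation u).toMeasurableEquiv.measurableEmbedding
    (fun z : ℂ => z ^ j * conj (z ^ k) * (W ‖z‖ : ℂ))
  have e : ∀ z : ℂ, rotation u z ^ j * conj (rotation u z ^ k) * (W ‖rotation u z‖ : ℂ) =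
      -1 * (z ^ j * conj (z ^ k) * (W ‖z‖ : ℂ)) := fun z => by
    rw [LinearIsometryEquiv.norm_map, rotation_apply, mul_pow, mul_pow, map_mul, ← hu]
    ring
  simp only [e] at h
  rw [integral_const_mul] at h
  linear_combination -(1 / 2) * h

/-- Equality can fail at the origin: since `Real.log 0 = 0` the left side is 1 there, while the
power vanishes when cN > 0. -/
theorem exp_inducedGinibrePotential_ae (c : ℝ) (N : ℕ) :
    (fun z : ℂ => Real.exp (-(N : ℝ) * inducedGinibrePotential c z)) =ᵐ[volume]
      fun z => ‖z‖ ^ (2 * c * N) * Real.exp (-(N : ℝ) * ‖z‖ ^ (2 : ℝ)) := by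
  filter_upwards [compl_mem_ae_iff.mpr (measure_singleton (0 : ℂ))] with z hz
  have hz0 : 0 < ‖z‖ := norm_pos_iff.mpr hz
  rw [Real.rpow_def_of_pos hz0, ← Real.exp_add, inducedGinibrePotential, Real.rpow_two]
  congr 1
  ring

theorem partitionFunction_induced_eq_prod {c : ℝ} (hc : 0 ≤ c) {N : ℕ} (hN : 1 ≤ N) :
    partitionFunction N (inducedGinibrePotential c) = N.factorial * ∏ j ∈ Finset.range N,
      (Real.Gamma (c * N + 1 + j) * (N : ℝ) ^ (-(c * N + 1 + j))) := by
  have hN0 : (0 : ℝ) < N := by exact_mod_cast hN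
  have hq : ∀ j : ℕ, (0 : ℝ) ≤ j + j + 2 * c * N := fun j => by positivity
  have hae : ∀ j k : ℕ, (fun z : ℂ => z ^ j * conj (z ^ k) *
      ((Real.exp (-(N : ℝ) * inducedGinibrePotential c z) : ℝ) : ℂ)) =ᵐ[volume]
      fun z => z ^ j * conj (z ^ k) *
        ((‖z‖ ^ (2 * c * N) * Real.exp (-(N : ℝ) * ‖z‖ ^ (2 : ℝ)) : ℝ) : ℂ) := fun j k => by
    filter_upwards [exp_inducedGinibrePotential_ae c N] with z hz
    rw [hz]
  refine integral_prod_norm_sub_sq areaMeasure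
    (fun z => Real.exp (-(N : ℝ) * inducedGinibrePotential c z)) (fun j => Polynomial.X ^ j)
    (fun j => Polynomial.monic_X_pow j) (fun j => Polynomial.natDegree_X_pow j)
    (fun j => Real.Gamma (c * N + 1 + j) * (N : ℝ) ^ (-(c * N + 1 + j))) (fun j k => ?_)
    (fun j k => ?_) N
  · simp only [Polynomial.eval_pow, Polynomial.eval_X]
    refine integrable_areaMeasure (Integrable.congr ?_ (hae j k).symm)
    have hm : Measurable fun z : ℂ => z ^ j * conj (z ^ k) *
        ((‖z‖ ^ (2 * c * N) * Real.exp (-(N : ℝ) * ‖z‖ ^ (2 : ℝ)) : ℝ) : ℂ) := by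
      fun_prop
    refine (integrable_norm_rpow_mul_exp (q := j + k + 2 * c * N) (by positivity) hN0).mono'
      hm.aestronglyMeasurable (ae_of_all _ fun z => le_of_eq ?_)
    rw [norm_mul, norm_mul, Complex.norm_conj, norm_pow, norm_pow, Complex.norm_real,
      Real.norm_of_nonneg (by positivity), Real.rpow_add_of_nonneg (norm_nonneg _) (by positivity)
      (by positivity), Real.rpow_add_of_nonneg (norm_nonneg _) (by positivity)
      (by positivity), Real.rpow_natCast, Real.rpow_natCast]
    ring
  · simp only [Polynomial.eval_pow, Polynomial.eval_X]
    rw [integral_areaMeasure, integral_congr_ae (hae j k)]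
    split_ifs with hjk
    · subst hjk
      have h1 : ∀ z : ℂ, z ^ j * conj (z ^ j) *
        ((‖z‖ ^ (2 * c * N) * Real.exp (-(N : ℝ) * ‖z‖ ^ (2 : ℝ)) : ℝ) : ℂ) =
        ((‖z‖ ^ (j + j + 2 * c * N) * Real.exp (-(N : ℝ) * ‖z‖ ^ (2 : ℝ)) : ℝ) : ℂ) := fun z => by
        rw [Real.rpow_add_of_nonneg (norm_nonneg _) (by positivity)
          (by positivity), Real.rpow_add_of_nonneg (norm_nonneg _) (by positivity)
          (by positivity), Real.rpow_natCast, Complex.mul_conj', norm_pow]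
        push_cast
        ring
      simp only [h1]
      rw [integral_complex_ofReal, Complex.integral_rpow_mul_exp_neg_mul_rpow one_le_two
        (by linarith [hq j]) hN0, show (j + j + 2 * c * N + 2) / 2 = c * N + 1 + j by ring,
        show -(j + j + 2 * c * N + 2) / 2 = -(c * N + 1 + j) by ring]
      have := Real.pi_ne_zero
      norm_cast
      field_simp
    · rw [integral_pow_mul_conj_pow_eq_zero hjk
        (fun r => r ^ (2 * c * N) * Real.exp (-(N : ℝ) * r ^ (2 : ℝ))), mul_zero]

theorem partitionFunction_induced {c : ℝ} (hc : 0 ≤ c) {N : ℕ} (hN : 1 ≤ N) :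
    partitionFunction N (inducedGinibrePotential c) =
      (N.factorial : ℝ) * (barnesG ((N : ℝ) + c * (N : ℝ) + 1) / barnesG (c * (N : ℝ) + 1)) *
        (N : ℝ) ^ (-(c + 1 / 2) * (N : ℝ) ^ 2 - 1 / 2 * (N : ℝ)) := by
  have hN0 : (0 : ℝ) < N := by exact_mod_cast hN
  have h1 : 1 ≤ c * N + 1 := by
    have : 0 ≤ c * N := by positivity
    linarith
  rw [partitionFunction_induced_eq_prod hc hN, Finset.prod_mul_distrib,
    ← Real.rpow_sum_of_pos hN0, show (N : ℝ) + c * N + 1 = c * N + 1 + N by ring,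
    barnesG_add_natCast h1, mul_div_cancel_right₀ _ (barnesG_pos h1).ne', mul_assoc]
  congr 3
  rw [Finset.sum_neg_distrib, Finset.sum_add_distrib, Finset.sum_const, Finset.card_range,
    ← Nat.cast_sum, nsmul_eq_mul]
  have := Finset.sum_range_id_mul_two N
  have h2 : ((∑ i ∈ Finset.range N, i : ℕ) : ℝ) * 2 = N * (N - 1) := by
    rw [← Nat.cast_two, ← Nat.cast_mul, this, Nat.cast_mul, Nat.cast_sub hN, Nat.cast_one]
  linear_combination -(1 / 2) * h2

/-! ### The elliptic Ginibre potential and Hermite polynomials -/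

/-- The anisotropic Gaussian weight `exp (-(a x² + b y²))` on the complex plane. -/
def gaussianWeight (a b : ℝ) (z : ℂ) : ℝ :=
  Real.exp (-(a * z.re ^ 2 + b * z.im ^ 2))

theorem gaussianWeight_pos (a b : ℝ) (z : ℂ) : 0 < gaussianWeight a b z :=
  Real.exp_pos _

theorem continuous_gaussianWeight (a b : ℝ) : Continuous (gaussianWeight a b) := by
  unfold gaussianWeight
  fun_prop

theorem gaussianWeight_le {a b : ℝ} (z : ℂ) :
    gaussianWeight a b z ≤ Real.exp (-(min a b) * ‖z‖ ^ (2 : ℝ)) := by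
  rw [gaussianWeight, Real.exp_le_exp, Real.rpow_two, ← Complex.normSq_eq_norm_sq,
    Complex.normSq_apply]
  nlinarith [min_le_left a b, min_le_right a b, mul_nonneg (sub_nonneg.mpr (min_le_left a b))
    (sq_nonneg z.re), mul_nonneg (sub_nonneg.mpr (min_le_right a b)) (sq_nonneg z.im)]

theorem integrable_eval_mul_conj_eval {a b : ℝ} (ha : 0 < a) (hb : 0 < b) (p q : Polynomial ℂ) :
    Integrable fun z => p.eval z * conj (q.eval z) * (gaussianWeight a b z : ℂ) := by
  have hc : Continuous fun z : ℂ => (gaussianWeight a b z : ℂ) :=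
    Complex.continuous_ofReal.comp (continuous_gaussianWeight a b)
  induction p using Polynomial.induction_on' with
  | add p₁ p₂ h₁ h₂ =>
    refine (h₁.add h₂).congr (ae_of_all _ fun z => ?_)
    simp only [Pi.add_apply, Polynomial.eval_add]
    ring
  | monomial m α =>
    induction q using Polynomial.induction_on' with
    | add q₁ q₂ h₁ h₂ =>
      refine (h₁.add h₂).congr (ae_of_all _ fun z => ?_)
      simp only [Pi.add_apply, Polynomial.eval_add, map_add]
      ring
    | monomial n β =>
      simp only [Polynomial.eval_monomial]
      refine ((integrable_norm_rpow_mul_exp (q := m + n) (by positivity)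
        (lt_min ha hb)).const_mul (‖α‖ * ‖β‖)).mono' ?_ (ae_of_all _ fun z => ?_)
      · exact Continuous.aestronglyMeasurable (by fun_prop)
      · rw [norm_mul, norm_mul, Complex.norm_conj, norm_mul, norm_mul, norm_pow, norm_pow,
          Complex.norm_real, Real.norm_of_nonneg (gaussianWeight_pos a b z).le,
          Real.rpow_add_of_nonneg (norm_nonneg _) (by positivity) (by positivity),
          Real.rpow_natCast, Real.rpow_natCast]
        calc ‖α‖ * ‖z‖ ^ m * (‖β‖ * ‖z‖ ^ n) * gaussianWeight a b z
            = ‖α‖ * ‖β‖ * (‖z‖ ^ m * ‖z‖ ^ n * gaussianWeight a b z) := by ring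
          _ ≤ _ := by
            gcongr
            exact gaussianWeight_le z

/-- The sesquilinear form of the weight `gaussianWeight a b` on polynomials. -/
def gaussianForm (a b : ℝ) (p q : Polynomial ℂ) : ℂ :=
  ∫ z, p.eval z * conj (q.eval z) * (gaussianWeight a b z : ℂ)

theorem hasDerivAt_add_smul (z v : ℂ) (t : ℝ) : HasDerivAt (fun t : ℝ => z + t • v) v t := by
  simpa using ((hasDerivAt_id t).smul_const v).const_add z

theorem hasLineDerivAt_eval_mul_conj_eval (p q : Polynomial ℂ) (z v : ℂ) :
    HasLineDerivAt ℝ (fun z => p.eval z * conj (q.eval z))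
      (p.derivative.eval z * v * conj (q.eval z) +
        p.eval z * conj (q.derivative.eval z * v)) z v := by
  have he : ∀ p : Polynomial ℂ, HasDerivAt (fun t : ℝ => p.eval (z + t • v))
      (p.derivative.eval z * v) 0 := fun p => by
    have h := hasDerivAt_add_smul z v 0
    have hp : HasDerivAt (fun z => p.eval z) (p.derivative.eval z) (z + (0 : ℝ) • v) := by
      simpa using p.hasDerivAt z
    exact hp.comp 0 h
  have := (he p).mul (he q).star
  rw [HasLineDerivAt]
  refine this.congr_deriv ?_
  simp

theorem hasLineDerivAt_gaussianWeight (a b : ℝ) (z v : ℂ) :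
    HasLineDerivAt ℝ (fun z => (gaussianWeight a b z : ℂ))
      (-(2 * a * z.re * v.re + 2 * b * z.im * v.im) * (gaussianWeight a b z : ℂ)) z v := by
  have h := hasDerivAt_add_smul z v 0
  have hre : HasDerivAt (fun t : ℝ => (z + t • v).re) v.re 0 :=
    (Complex.reCLM.hasFDerivAt.comp_hasDerivAt (0 : ℝ) h)
  have him : HasDerivAt (fun t : ℝ => (z + t • v).im) v.im 0 :=
    (Complex.imCLM.hasFDerivAt.comp_hasDerivAt (0 : ℝ) h)
  have := ((((hre.pow 2).const_mul a).add ((him.pow 2).const_mul b)).neg.exp).ofReal_comp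
  rw [HasLineDerivAt]
  refine this.congr_deriv ?_
  simp only [zero_smul, add_zero, gaussianWeight, Pi.neg_apply, Pi.add_apply, Pi.pow_apply]
  push_cast
  ring

theorem integrable_re_mul {f : ℂ → ℂ} (hf : AEStronglyMeasurable f)
    (h : Integrable fun z => z * f z) : Integrable fun z => (z.re : ℂ) * f z := by
  refine h.mono ?_ (ae_of_all _ fun z => ?_)
  · exact (Continuous.aestronglyMeasurable (by fun_prop)).mul hf
  · rw [norm_mul, norm_mul, Complex.norm_real]
    gcongr
    exact Complex.abs_re_le_norm z

theorem integrable_im_mul {f : ℂ → ℂ} (hf : AEStronglyMeasurable f)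
    (h : Integrable fun z => z * f z) : Integrable fun z => (z.im : ℂ) * f z := by
  refine h.mono ?_ (ae_of_all _ fun z => ?_)
  · exact (Continuous.aestronglyMeasurable (by fun_prop)).mul hf
  · rw [norm_mul, norm_mul, Complex.norm_real]
    gcongr
    exact Complex.abs_im_le_norm z

/-- Integrating by parts in the directions 1 and i expresses multiplication by Re z and Im z through
derivatives of p and q; the combination Re z + i Im z gives multiplication by X. -/
theorem gaussianForm_X_mul {a b : ℝ} (ha : 0 < a) (hb : 0 < b) (p q : Polynomial ℂ) :
    gaussianForm a b (Polynomial.X * p) q =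
      (1 / (2 * a) - 1 / (2 * b)) * gaussianForm a b p.derivative q +
      (1 / (2 * a) + 1 / (2 * b)) * gaussianForm a b p q.derivative := by
  have hI := integrable_eval_mul_conj_eval ha hb
  have hz : Integrable fun z : ℂ => z * (p.eval z * conj (q.eval z) * (gaussianWeight a b z : ℂ)) := by
    refine (hI (Polynomial.X * p) q).congr (ae_of_all _ fun z => ?_)
    simp only [Polynomial.eval_mul, Polynomial.eval_X]
    ring
  have hre := integrable_re_mul (hI p q).aestronglyMeasurable hz
  have him := integrable_im_mul (hI p q).aestronglyMeasurable hz
  have hibp : ∀ v : ℂ, ∫ z : ℂ, (2 * a * z.re * v.re + 2 * b * z.im * v.im) *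
      (p.eval z * conj (q.eval z) * (gaussianWeight a b z : ℂ)) =
      v * gaussianForm a b p.derivative q + conj v * gaussianForm a b p q.derivative := fun v => by
    have e1 : ∀ z : ℂ, (p.derivative.eval z * v * conj (q.eval z) +
        p.eval z * conj (q.derivative.eval z * v)) * (gaussianWeight a b z : ℂ) =
        v * (p.derivative.eval z * conj (q.eval z) * (gaussianWeight a b z : ℂ)) +
        conj v * (p.eval z * conj (q.derivative.eval z) * (gaussianWeight a b z : ℂ)) := fun z => by
      rw [map_mul]; ring
    have e2 : ∀ z : ℂ, p.eval z * conj (q.eval z) *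
        (-(2 * a * z.re * v.re + 2 * b * z.im * v.im) * (gaussianWeight a b z : ℂ)) =
        (-(2 * a * v.re)) * ((z.re : ℂ) * (p.eval z * conj (q.eval z) * (gaussianWeight a b z : ℂ))) +
        (-(2 * b * v.im)) * ((z.im : ℂ) * (p.eval z * conj (q.eval z) * (gaussianWeight a b z : ℂ))) :=
      fun z => by ring
    have h := integral_bilinear_hasLineDerivAt_right_eq_neg_left_of_integrable (μ := volume)
      (f := fun z => p.eval z * conj (q.eval z)) (g := fun z => (gaussianWeight a b z : ℂ))
      (B := ContinuousLinearMap.mul ℝ ℂ) (v := v)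
      (hf'g := by
        simp only [ContinuousLinearMap.mul_apply', e1]
        exact ((hI p.derivative q).const_mul v).add ((hI p q.derivative).const_mul (conj v)))
      (hfg' := by
        simp only [ContinuousLinearMap.mul_apply', e2]
        exact (hre.const_mul _).add (him.const_mul _))
      (hfg := by simpa only [ContinuousLinearMap.mul_apply'] using hI p q)
      (fun z _ => hasLineDerivAt_eval_mul_conj_eval p q z v)
      (fun z _ => hasLineDerivAt_gaussianWeight a b z v)
    simp only [ContinuousLinearMap.mul_apply', e1] at h
    rw [integral_add ((hI p.derivative q).const_mul v) ((hI p q.derivative).const_mul (conj v)),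
      integral_const_mul, integral_const_mul] at h
    rw [gaussianForm, gaussianForm, ← neg_eq_iff_eq_neg.mpr h, ← integral_neg]
    congr 1
    ext z
    ring
  have h1 := hibp 1
  have h2 := hibp Complex.I
  simp only [Complex.one_re, Complex.one_im, Complex.I_re, Complex.I_im, Complex.ofReal_one,
    Complex.ofReal_zero, mul_zero, mul_one, add_zero, zero_add, map_one, one_mul, mul_assoc,
    Complex.conj_I] at h1 h2
  simp only [integral_const_mul] at h1 h2
  have h3 : gaussianForm a b (Polynomial.X * p) q =
      (∫ z : ℂ, (z.re : ℂ) * (p.eval z * (conj (q.eval z) * (gaussianWeight a b z : ℂ)))) +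
      Complex.I * ∫ z : ℂ, (z.im : ℂ) * (p.eval z * (conj (q.eval z) * (gaussianWeight a b z : ℂ))) := by
    simp only [mul_assoc] at hre him
    rw [gaussianForm, ← integral_const_mul, ← integral_add hre (him.const_mul _)]
    congr 1
    ext z
    rw [Polynomial.eval_mul, Polynomial.eval_X]
    nth_rewrite 1 [← Complex.re_add_im z]
    ring
  have ha' : (a : ℂ) ≠ 0 := by exact_mod_cast ha.ne'
  have hb' : (b : ℂ) ≠ 0 := by exact_mod_cast hb.ne'
  rw [h3]
  have e1 : (2 * a * b : ℂ) * (1 / (2 * a) - 1 / (2 * b)) = b - a := by field_simp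
  have e2 : (2 * a * b : ℂ) * (1 / (2 * a) + 1 / (2 * b)) = b + a := by field_simp
  apply mul_left_cancel₀ (mul_ne_zero (mul_ne_zero two_ne_zero ha') hb')
  linear_combination (b : ℂ) * h1 + a * Complex.I * h2 - gaussianForm a b p.derivative q * e1 -
    gaussianForm a b p q.derivative * e2 + a * (gaussianForm a b p.derivative q -
    gaussianForm a b p q.derivative) * Complex.I_sq

/-- Monic Hermite polynomials with recurrence `P_{k+2} = X P_{k+1} - ν (k + 1) P_k`. -/
def hermiteScaled (ν : ℂ) : ℕ → Polynomial ℂ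
  | 0 => 1
  | 1 => Polynomial.X
  | k + 2 => Polynomial.X * hermiteScaled ν (k + 1) -
      Polynomial.C (ν * (k + 1)) * hermiteScaled ν k

theorem hermiteScaled_monic_natDegree (ν : ℂ) (k : ℕ) :
    (hermiteScaled ν k).Monic ∧ (hermiteScaled ν k).natDegree = k := by
  induction k using Nat.twoStepInduction with
  | zero => exact ⟨Polynomial.monic_one, Polynomial.natDegree_one⟩
  | one => exact ⟨Polynomial.monic_X, Polynomial.natDegree_X⟩
  | more k h0 h1 =>
    have hm : (Polynomial.X * hermiteScaled ν (k + 1)).Monic := Polynomial.monic_X.mul h1.1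
    have hd : (Polynomial.X * hermiteScaled ν (k + 1)).natDegree = k + 2 := by
      rw [Polynomial.natDegree_X_mul h1.1.ne_zero, h1.2]
    have hlt : (Polynomial.C (ν * (k + 1)) * hermiteScaled ν k).natDegree <
        (Polynomial.X * hermiteScaled ν (k + 1)).natDegree := by
      rw [hd]
      exact (Polynomial.natDegree_C_mul_le _ _).trans_lt (by omega)
    exact ⟨hm.sub_of_left (Polynomial.degree_lt_degree hlt),
      (Polynomial.natDegree_sub_eq_left_of_natDegree_lt hlt).trans hd⟩

theorem derivative_hermiteScaled (ν : ℂ) (k : ℕ) :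
    (hermiteScaled ν (k + 1)).derivative = Polynomial.C (k + 1 : ℂ) * hermiteScaled ν k := by
  induction k using Nat.twoStepInduction with
  | zero => simp [hermiteScaled]
  | one =>
    simp [hermiteScaled]
    ring
  | more k h0 h1 =>
    rw [hermiteScaled, Polynomial.derivative_sub, Polynomial.derivative_mul,
      Polynomial.derivative_C_mul, h1, h0, Polynomial.derivative_X, hermiteScaled]
    simp only [map_add, map_mul, map_one, map_natCast, Nat.cast_add, Nat.cast_one]
    ring

theorem gaussianForm_sub_left {a b : ℝ} (ha : 0 < a) (hb : 0 < b) (p₁ p₂ q : Polynomial ℂ) :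
    gaussianForm a b (p₁ - p₂) q = gaussianForm a b p₁ q - gaussianForm a b p₂ q := by
  rw [gaussianForm, gaussianForm, gaussianForm, ← integral_sub
    (integrable_eval_mul_conj_eval ha hb p₁ q) (integrable_eval_mul_conj_eval ha hb p₂ q)]
  congr 1
  ext z
  rw [Polynomial.eval_sub]
  ring

theorem gaussianForm_C_mul_left (a b : ℝ) (α : ℂ) (p q : Polynomial ℂ) :
    gaussianForm a b (Polynomial.C α * p) q = α * gaussianForm a b p q := by
  rw [gaussianForm, gaussianForm, ← integral_const_mul]
  congr 1
  ext z
  rw [Polynomial.eval_C_mul]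
  ring

theorem conj_gaussianForm (a b : ℝ) (p q : Polynomial ℂ) :
    conj (gaussianForm a b p q) = gaussianForm a b q p := by
  rw [gaussianForm, gaussianForm, ← integral_conj]
  congr 1
  ext z
  simp only [map_mul, Complex.conj_conj, Complex.conj_ofReal]
  ring

theorem gaussianForm_C_mul_right (a b : ℝ) (α : ℂ) (p q : Polynomial ℂ) :
    gaussianForm a b p (Polynomial.C α * q) = conj α * gaussianForm a b p q := by
  rw [← conj_gaussianForm, gaussianForm_C_mul_left, map_mul, conj_gaussianForm]

/-- With this choice of ν, the subtracted term of the recurrence cancels the p' term of the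
integration by parts, because P_{k+1}' = (k+1)P_k. -/
theorem gaussianForm_hermiteScaled_succ {a b : ℝ} (ha : 0 < a) (hb : 0 < b) (k : ℕ)
    (q : Polynomial ℂ) :
    gaussianForm a b (hermiteScaled (1 / (2 * a) - 1 / (2 * b)) (k + 1)) q =
      (1 / (2 * a) + 1 / (2 * b)) *
        gaussianForm a b (hermiteScaled (1 / (2 * a) - 1 / (2 * b)) k) q.derivative := by
  cases k with
  | zero =>
    have h := gaussianForm_X_mul ha hb 1 q
    rw [mul_one, Polynomial.derivative_one] at h
    rw [hermiteScaled, hermiteScaled, h]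
    simp [gaussianForm]
  | succ k =>
    rw [hermiteScaled, gaussianForm_sub_left ha hb, gaussianForm_X_mul ha hb,
      derivative_hermiteScaled, gaussianForm_C_mul_left, gaussianForm_C_mul_left]
    ring

/-- Each index is lowered in turn: one step moves a derivative to the other polynomial, which is
again Hermite. Unequal degrees end in a pairing with 1' = 0. -/
theorem gaussianForm_hermiteScaled {a b : ℝ} (ha : 0 < a) (hb : 0 < b) (j k : ℕ) :
    gaussianForm a b (hermiteScaled (1 / (2 * a) - 1 / (2 * b)) j)
      (hermiteScaled (1 / (2 * a) - 1 / (2 * b)) k) =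
      if j = k then (1 / (2 * a) + 1 / (2 * b)) ^ j * j.factorial * gaussianForm a b 1 1 else 0 := by
  have h0 : ∀ j : ℕ, gaussianForm a b (hermiteScaled (1 / (2 * a) - 1 / (2 * b)) (j + 1)) 1 = 0 :=
    fun j => by
      rw [gaussianForm_hermiteScaled_succ ha hb, Polynomial.derivative_one]
      simp [gaussianForm]
  induction j generalizing k with
  | zero =>
    cases k with
    | zero => simp [hermiteScaled]
    | succ k =>
      rw [if_neg (by omega), ← conj_gaussianForm, hermiteScaled, h0, map_zero]
  | succ j ih =>
    cases k with
    | zero => rw [if_neg (by omega), hermiteScaled, h0]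
    | succ k =>
      rw [gaussianForm_hermiteScaled_succ ha hb, derivative_hermiteScaled,
        gaussianForm_C_mul_right, ih k]
      by_cases hjk : j = k
      · subst hjk
        rw [if_pos rfl, if_pos rfl, Nat.factorial_succ]
        simp only [map_add, map_one, map_natCast]
        push_cast
        ring
      · rw [if_neg hjk, if_neg (by omega)]
        simp

theorem gaussianForm_one_one (a b : ℝ) :
    gaussianForm a b 1 1 = ((√(Real.pi / a) * √(Real.pi / b) : ℝ) : ℂ) := by
  have h : gaussianForm a b 1 1 = ∫ z : ℂ, ((gaussianWeight a b z : ℝ) : ℂ) := by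
    simp [gaussianForm]
  rw [h, integral_complex_ofReal, ← integral_gaussian, ← integral_gaussian, ← integral_prod_mul,
    ← Measure.volume_eq_prod, ← Complex.volume_preserving_equiv_real_prod.integral_comp
      Complex.measurableEquivRealProd.measurableEmbedding]
  congr 2
  ext z
  rw [gaussianWeight, ← Real.exp_add]
  congr 1
  simp only [Complex.measurableEquivRealProd_apply]
  ring

theorem exp_ellipticGinibrePotential {τ : ℝ} (h0 : 0 ≤ τ) (h1 : τ < 1) (N : ℕ) (z : ℂ) :
    Real.exp (-(N : ℝ) * ellipticGinibrePotential τ z) =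
      gaussianWeight (N / (1 + τ)) (N / (1 - τ)) z := by
  have e1 : (1 + τ) ≠ 0 := by linarith
  have e2 : (1 - τ) ≠ 0 := by linarith
  have e3 : 1 - τ ^ 2 = (1 + τ) * (1 - τ) := by ring
  rw [ellipticGinibrePotential, gaussianWeight, ← Complex.normSq_eq_norm_sq,
    Complex.normSq_apply, e3]
  congr 1
  simp only [pow_two, Complex.mul_re]
  field_simp
  ring

theorem partitionFunction_elliptic_eq_prod {τ : ℝ} (h0 : 0 ≤ τ) (h1 : τ < 1) {N : ℕ}
    (hN : 1 ≤ N) :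
    partitionFunction N (ellipticGinibrePotential τ) = N.factorial * ∏ j ∈ Finset.range N,
      (j.factorial * √(1 - τ ^ 2) / (N : ℝ) ^ (j + 1)) := by
  have hN0 : (0 : ℝ) < N := by exact_mod_cast hN
  have ht1 : 0 < 1 + τ := by linarith
  have ht2 : 0 < 1 - τ := by linarith
  have ha : 0 < N / (1 + τ) := by positivity
  have hb : 0 < N / (1 - τ) := by positivity
  set a := N / (1 + τ) with hadef
  set b := N / (1 - τ) with hbdef
  -- The lowering constant is independent of τ, so τ enters the norms only through the total
  -- Gaussian mass.
  have hκ : (1 / (2 * a) + 1 / (2 * b) : ℂ) = ((1 / N : ℝ) : ℂ) := by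
    rw [hadef, hbdef]
    norm_cast
    field_simp
    ring
  have hsq : √(Real.pi / a) * √(Real.pi / b) = Real.pi * √(1 - τ ^ 2) / N := by
    rw [← Real.sqrt_mul (by positivity), show Real.pi / a * (Real.pi / b) =
      (Real.pi / N) ^ 2 * (1 - τ ^ 2) by rw [hadef, hbdef]; field_simp; ring,
      Real.sqrt_mul (by positivity), Real.sqrt_sq (by positivity)]
    ring
  have hw : ∀ z : ℂ, Real.exp (-(N : ℝ) * ellipticGinibrePotential τ z) =
      gaussianWeight a b z := exp_ellipticGinibrePotential h0 h1 N
  refine integral_prod_norm_sub_sq areaMeasure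
    (fun z => Real.exp (-(N : ℝ) * ellipticGinibrePotential τ z))
    (hermiteScaled (1 / (2 * a) - 1 / (2 * b)))
    (fun j => (hermiteScaled_monic_natDegree _ j).1) (fun j => (hermiteScaled_monic_natDegree _ j).2)
    (fun j => j.factorial * √(1 - τ ^ 2) / (N : ℝ) ^ (j + 1)) (fun j k => ?_) (fun j k => ?_) N
  · simp only [hw]
    exact integrable_areaMeasure (integrable_eval_mul_conj_eval ha hb _ _)
  · simp only [hw]
    rw [integral_areaMeasure, ← gaussianForm, gaussianForm_hermiteScaled ha hb]
    split_ifs with hjk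
    · rw [hκ, gaussianForm_one_one, hsq]
      have := Real.pi_ne_zero
      norm_cast
      rw [div_pow, one_pow]
      push_cast
      field_simp
      ring
    · rw [mul_zero]

theorem partitionFunction_elliptic {τ : ℝ} (h0 : 0 ≤ τ) (h1 : τ < 1) {N : ℕ} (hN : 1 ≤ N) :
    partitionFunction N (ellipticGinibrePotential τ) =
      (1 - τ ^ 2) ^ ((N : ℝ) / 2) * barnesG ((N : ℝ) + 2) *
        (N : ℝ) ^ (-(1 / 2) * (N : ℝ) ^ 2 - 1 / 2 * (N : ℝ)) := by
  have hN0 : (0 : ℝ) < N := by exact_mod_cast hN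
  have ht : 0 < 1 - τ ^ 2 := by nlinarith
  have hG : barnesG ((N : ℝ) + 2) = N.factorial * ∏ j ∈ Finset.range N, (j.factorial : ℝ) := by
    have h := barnesG_add_natCast (x := 1) le_rfl (N + 1)
    push_cast at h
    rw [show (N : ℝ) + 2 = 1 + (N + 1) by ring, h, barnesG_one, mul_one, Finset.prod_range_succ,
      mul_comm]
    congr 1
    · rw [add_comm, Real.Gamma_nat_eq_factorial]
    · refine Finset.prod_congr rfl fun j _ => ?_
      rw [add_comm, Real.Gamma_nat_eq_factorial]
  have hs : ∏ j ∈ Finset.range N, √(1 - τ ^ 2) = (1 - τ ^ 2) ^ ((N : ℝ) / 2) := by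
    rw [Finset.prod_const, Finset.card_range, Real.sqrt_eq_rpow, ← Real.rpow_mul_natCast ht.le]
    congr 1
    ring
  have hp : ∏ j ∈ Finset.range N, (N : ℝ) ^ (j + 1) =
      (N : ℝ) ^ (1 / 2 * (N : ℝ) ^ 2 + 1 / 2 * (N : ℝ)) := by
    rw [Finset.prod_pow_eq_pow_sum, ← Real.rpow_natCast, Finset.sum_add_distrib, Finset.sum_const,
      Finset.card_range, smul_eq_mul, mul_one]
    congr 1
    have := Finset.sum_range_id_mul_two N
    have h2 : ((∑ i ∈ Finset.range N, i : ℕ) : ℝ) * 2 = N * (N - 1) := by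
      rw [← Nat.cast_two, ← Nat.cast_mul, this, Nat.cast_mul, Nat.cast_sub hN, Nat.cast_one]
    rw [Nat.cast_add]
    linear_combination (1 / 2) * h2
  rw [partitionFunction_elliptic_eq_prod h0 h1 hN, Finset.prod_div_distrib,
    Finset.prod_mul_distrib, hs, hp, hG, show -(1 / 2) * (N : ℝ) ^ 2 - 1 / 2 * (N : ℝ) =
      -(1 / 2 * (N : ℝ) ^ 2 + 1 / 2 * (N : ℝ)) by ring, Real.rpow_neg hN0.le]
  ring

/-! ### Asymptotic expansions of the partition functions -/

theorem log_factorial_sub_stirlingSeries_isBigO (K : ℕ) :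
    (fun N : ℕ => Real.log N.factorial - stirlingSeries K N) =O[atTop]
      fun N => 1 / (N : ℝ) ^ (2 * K + 1) := by
  refine ((log_Gamma_sub_stirlingSeries_isBigO K).comp_tendsto
    tendsto_natCast_atTop_atTop).congr_left fun N => ?_
  rw [Function.comp_apply, Real.Gamma_nat_eq_factorial]

theorem log_barnesG_mul_natCast_sub_isBigO {t : ℝ} (ht : 0 < t) (K : ℕ) :
    (fun N : ℕ => Real.log (barnesG (t * N + 1)) -
      (barnesSeries K (t * N) + (deriv riemannZeta (-1)).re)) =O[atTop]
      fun N => 1 / (N : ℝ) ^ (2 * K + 1) := by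
  have h := (log_barnesG_sub_isBigO tendsto_logHyperfactorial_sub K).comp_tendsto
    (tendsto_natCast_atTop_atTop.const_mul_atTop ht : Tendsto (fun N : ℕ => t * (N : ℝ)) atTop atTop)
  -- The available error is N^(-2K-2); one power is given up to match the error of log N!.
  refine (h.congr_left fun N => ?_).trans (IsBigO.of_bound (1 / t ^ (2 * K + 2)) ?_)
  · rw [Function.comp_apply]
    ring
  · filter_upwards [eventually_ge_atTop 1] with N hN
    have hN1 : (1 : ℝ) ≤ N := by exact_mod_cast hN
    rw [Function.comp_apply, Real.norm_of_nonneg (by positivity),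
      Real.norm_of_nonneg (by positivity), mul_pow, ← one_div_mul_one_div]
    gcongr
    exact one_le_two

theorem log_partitionFunction_induced {c : ℝ} (hc : 0 ≤ c) {N : ℕ} (hN : 1 ≤ N) :
    Real.log (partitionFunction N (inducedGinibrePotential c)) =
      Real.log N.factorial + Real.log (barnesG ((c + 1) * N + 1)) - Real.log (barnesG (c * N + 1)) +
        (-(c + 1 / 2) * (N : ℝ) ^ 2 - 1 / 2 * N) * Real.log N := by
  have hN0 : (0 : ℝ) < N := by exact_mod_cast hN
  have hcN : 0 ≤ c * N := by positivity
  have h1 := barnesG_pos (x := c * N + 1) (by linarith)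
  have h2 := barnesG_pos (x := (c + 1) * N + 1) (by linarith)
  rw [partitionFunction_induced hc hN, show (N : ℝ) + c * N + 1 = (c + 1) * N + 1 by ring,
    Real.log_mul (by positivity) (by positivity), Real.log_mul (by positivity) (by positivity),
    Real.log_div h2.ne' h1.ne', Real.log_rpow hN0]
  ring

theorem log_partitionFunction_elliptic {τ : ℝ} (h0 : 0 ≤ τ) (h1 : τ < 1) {N : ℕ} (hN : 1 ≤ N) :
    Real.log (partitionFunction N (ellipticGinibrePotential τ)) =
      N / 2 * Real.log (1 - τ ^ 2) + Real.log N.factorial + Real.log (barnesG (1 * N + 1)) +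
        (-(1 / 2) * (N : ℝ) ^ 2 - 1 / 2 * N) * Real.log N := by
  have hN0 : (0 : ℝ) < N := by exact_mod_cast hN
  have ht : 0 < 1 - τ ^ 2 := by nlinarith
  have hG := barnesG_pos (x := (N : ℝ) + 1) (by linarith)
  rw [partitionFunction_elliptic h0 h1 hN, show (N : ℝ) + 2 = N + 1 + 1 by ring,
    barnesG_add_one (by linarith), Real.Gamma_nat_eq_factorial, one_mul,
    Real.log_mul (by positivity) (by positivity), Real.log_mul (by positivity) (by positivity),
    Real.log_mul (by positivity) (by positivity), Real.log_rpow hN0, Real.log_rpow ht]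
  ring

end

theorem lemma3p1 :
    -- exact formula for the induced Ginibre potential
    (∀ c : ℝ, 0 ≤ c → ∀ N : ℕ, 1 ≤ N →
      partitionFunction N (inducedGinibrePotential c) =
        (N.factorial : ℝ) * (barnesG ((N : ℝ) + c * (N : ℝ) + 1) / barnesG (c * (N : ℝ) + 1)) *
          (N : ℝ) ^ (-(c + 1 / 2) * (N : ℝ) ^ 2 - 1 / 2 * (N : ℝ))) ∧
    -- exact formula for the elliptic Ginibre potential
    (∀ τ : ℝ, 0 ≤ τ → τ < 1 → ∀ N : ℕ, 1 ≤ N →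
      partitionFunction N (ellipticGinibrePotential τ) =
        (1 - τ ^ 2) ^ ((N : ℝ) / 2) * barnesG ((N : ℝ) + 2) *
          (N : ℝ) ^ (-(1 / 2) * (N : ℝ) ^ 2 - 1 / 2 * (N : ℝ))) ∧
    -- full asymptotic expansion for the induced Ginibre potential
    (∀ c : ℝ, 0 < c → ∀ K : ℕ,
      Asymptotics.IsBigO Filter.atTop
        (fun N : ℕ =>
          Real.log (partitionFunction N (inducedGinibrePotential c)) -
            (-(3 / 4 + 3 * c / 2 + c ^ 2 / 2 * Real.log c
                  - (c + 1) ^ 2 / 2 * Real.log (c + 1)) * (N : ℝ) ^ 2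
              + 1 / 2 * (N : ℝ) * Real.log (N : ℝ)
              + (Real.log (2 * Real.pi) / 2 - 1) * (N : ℝ)
              + 1 / 2 * Real.log (N : ℝ)
              + Real.log (2 * Real.pi) / 2
              + 1 / 12 * Real.log (c / (1 + c))
              + ∑ k ∈ Finset.Icc 1 K,
                  ((bernoulli (2 * k) : ℝ) / (2 * (k : ℝ) * (2 * (k : ℝ) - 1))
                      * (1 / (N : ℝ) ^ (2 * k - 1))
                    + (bernoulli (2 * k + 2) : ℝ) / (4 * (k : ℝ) * ((k : ℝ) + 1))
                      * (1 / (c + 1) ^ (2 * k) - 1 / c ^ (2 * k))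
                      * (1 / (N : ℝ) ^ (2 * k)))))
        (fun N : ℕ => 1 / (N : ℝ) ^ (2 * K + 1))) ∧
    -- full asymptotic expansion for the elliptic Ginibre potential
    (∀ τ : ℝ, 0 ≤ τ → τ < 1 → ∀ K : ℕ,
      Asymptotics.IsBigO Filter.atTop
        (fun N : ℕ =>
          Real.log (partitionFunction N (ellipticGinibrePotential τ)) -
            (-(3 / 4) * (N : ℝ) ^ 2
              + 1 / 2 * (N : ℝ) * Real.log (N : ℝ)
              + (Real.log (2 * Real.pi) / 2 - 1 + 1 / 2 * Real.log (1 - τ ^ 2)) * (N : ℝ)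
              + 5 / 12 * Real.log (N : ℝ)
              + Real.log (2 * Real.pi) / 2
              + (deriv riemannZeta (-1)).re
              + ∑ k ∈ Finset.Icc 1 K,
                  ((bernoulli (2 * k) : ℝ) / (2 * (k : ℝ) * (2 * (k : ℝ) - 1))
                      * (1 / (N : ℝ) ^ (2 * k - 1))
                    + (bernoulli (2 * k + 2) : ℝ) / (4 * (k : ℝ) * ((k : ℝ) + 1))
                      * (1 / (N : ℝ) ^ (2 * k)))))
        (fun N : ℕ => 1 / (N : ℝ) ^ (2 * K + 1))) := by
  refine ⟨fun c hc N hN => partitionFunction_induced hc hN,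
    fun τ h0 h1 N hN => partitionFunction_elliptic h0 h1 hN, fun c hc K => ?_,
    fun τ h0 h1 K => ?_⟩
  · have hc1 : 0 < c + 1 := by linarith
    -- ζ'(-1) cancels between the two Barnes functions, and their -(1/12) log terms leave (1/12)
    -- log(c/(1+c)).
    refine (((log_factorial_sub_stirlingSeries_isBigO K).add
      (log_barnesG_mul_natCast_sub_isBigO hc1 K)).sub
      (log_barnesG_mul_natCast_sub_isBigO hc K)).congr' ?_ .rfl
    filter_upwards [Filter.eventually_ge_atTop 1] with N hN
    have hN0 : (0 : ℝ) < N := by exact_mod_cast hN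
    rw [log_partitionFunction_induced hc.le hN, add_comm 1 c, Real.log_div hc.ne' hc1.ne',
      stirlingSeries, barnesSeries, barnesSeries, Real.log_mul hc.ne' hN0.ne',
      Real.log_mul hc1.ne' hN0.ne', Finset.sum_add_distrib]
    have hsum : ∑ k ∈ Finset.Icc 1 K, (bernoulli (2 * k + 2) : ℝ) / (4 * (k : ℝ) * ((k : ℝ) + 1))
          * (1 / (c + 1) ^ (2 * k) - 1 / c ^ (2 * k)) * (1 / (N : ℝ) ^ (2 * k)) =
        ∑ k ∈ Finset.Icc 1 K, (bernoulli (2 * k + 2) : ℝ) / (4 * (k : ℝ) * ((k : ℝ) + 1))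
          * (1 / ((c + 1) * (N : ℝ)) ^ (2 * k)) -
        ∑ k ∈ Finset.Icc 1 K, (bernoulli (2 * k + 2) : ℝ) / (4 * (k : ℝ) * ((k : ℝ) + 1))
          * (1 / (c * (N : ℝ)) ^ (2 * k)) := by
      rw [← Finset.sum_sub_distrib]
      refine Finset.sum_congr rfl fun k _ => ?_
      rw [mul_pow, mul_pow, ← one_div_mul_one_div, ← one_div_mul_one_div]
      ring
    rw [hsum]
    ring
  -- Here G(N+2) = N! G(N+1) is used with t = 1. The single Barnes function keeps ζ'(-1), and 1/2 -
  -- 1/12 = 5/12 is the coefficient of log N.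
  · refine ((log_factorial_sub_stirlingSeries_isBigO K).add
      (log_barnesG_mul_natCast_sub_isBigO one_pos K)).congr' ?_ .rfl
    filter_upwards [Filter.eventually_ge_atTop 1] with N hN
    rw [log_partitionFunction_elliptic h0 h1 hN, stirlingSeries, barnesSeries,
      Finset.sum_add_distrib, one_mul]
    ring
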